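/- Let $\Phi$ be a root system of type $C_\ell$, $\ell$ odd, in a Euclidean space $E$, with simple roots $\alpha_1,\dots,\alpha_\ell$ in the usual numbering; up to a similarity of $E\cong\mathbb R^\ell$, $$\Phi=\{\pm(e_i-e_j),\ \pm(e_i+e_j)\ (i<j),\ \pm 2e_k\},\qquad \alpha_i=e_i-e_{i+1}\ (i<\ell),\quad \alpha_\ell=2e_\ell .$$ Let $W$ be the Weyl group and $Z=\{x\in E : (\beta,x)\in\mathbb Z \text{ for all }\beta\in\Phi\}$ the coweight lattice. For a finite set $\Psi\subset E$ and a lattice $L$ in the span of $\Psi$ on which the elements of $\Psi$ take integer values, let $M(\Psi,L;q)$ be the set of classes $x+qL\in L/qL$ with $(\beta,x)\not\equiv 0 \pmod q$ for all $\beta\in\Psi$, and let $\chi^{\mathrm{quasi}}_{\Psi,L}(q)=\#M(\Psi,L;q)$. For $w\in W$ and a positive integer $q$ let $\chi_{\Phi,q}(w)$ be the value at $w$ of the permutation character of $W$ on $M(\Phi,Z;q)$, i.e. the number of points of $M(\Phi,Z;q)$ fixed by $w$. Let $\omega_\ell=w_\ell w_0\in W$, where $w_0$ is the longest element of $W$ and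 $w_\ell$ is the longest element of the subgroup generated by the reflections in $\alpha_1,\dots,\alpha_{\ell-1}$. **Theorem.** For every integer $q\ge 1$: 1. $\chi_{\Phi,q}(1)=\chi^{\mathrm{quasi}}_{\Phi,Z}(q)=\begin{cases}(q-1)(q-3)\cdots(q-(2\ell-1)) & \text{if } q \text{ is odd},\\ (q-2)(q-4)\cdots(q-2(\ell-1))\,(q-\ell) & \text{if } q \text{ is even.}\end{cases}$ 2. $\chi_{\Phi,q}(\omega_\ell)=\begin{cases}0 & \text{if } \gcd(4,q)=1,\\ (q-2)(q-6)\cdots(q-2(\ell-2)) & \text{if } \gcd(4,q)=2,\\ (q-4)(q-8)\cdots(q-2(\ell-1)) & \text{if } \gcd(4,q)=4,\end{cases}$ where the products in the last two cases have $(\ell-1)/2$ factors. 3. For $\beta\in\Phi$ let $\beta^{\omega_\ell}$ be the average of $\beta$ under the cyclic group generated by $\omega_\ell$. The set $\Phi_{\mathrm{re}}=\{\beta^{\omega_\ell} : \beta\in\Phi,\ \beta^{\omega_\ell}\ne 0\}$ is a root system of type $BC_{(\ell-1)/2}$ in its span, and, if $M$ denotes its coweight lattice, $\chi_{\Phi,q}(\omega_\ell)=\chi^{\mathrm{quasi}}_{2\Phi_{\mathrm{re}},M}(q)$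 for all even $q$. -/

import Mathlib

open scoped Pointwise

noncomputable section

namespace RootChar

section General

variable {E : Type*} [NormedAddCommGroup E] [InnerProductSpace ℝ E]

/-- The coweight lattice of `Φ`: the vectors `x` of the Euclidean space spanned by `Φ` such that
`(β, x)` is an integer for all `β ∈ Φ`. -/
def coweightLattice (Φ : Set E) : AddSubgroup E where
  carrier := {x | x ∈ Submodule.span ℝ Φ ∧ ∀ β ∈ Φ, ∃ n : ℤ, inner ℝ β x = (n : ℝ)}
  zero_mem' := ⟨Submodule.zero_mem _, fun β _ => ⟨0, by simp⟩⟩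
  add_mem' := by
    rintro x y ⟨hx, hx'⟩ ⟨hy, hy'⟩
    refine ⟨Submodule.add_mem _ hx hy, fun β hβ => ?_⟩
    obtain ⟨m, hm⟩ := hx' β hβ
    obtain ⟨n, hn⟩ := hy' β hβ
    exact ⟨m + n, by rw [inner_add_right, hm, hn]; push_cast; rfl⟩
  neg_mem' := by
    rintro x ⟨hx, hx'⟩
    refine ⟨Submodule.neg_mem _ hx, fun β hβ => ?_⟩
    obtain ⟨m, hm⟩ := hx' β hβ
    exact ⟨-m, by rw [inner_neg_right, hm]; push_cast; rfl⟩

/-- The quotient `L / qL` of a lattice `L`. -/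
abbrev ModQ (L : AddSubgroup E) (q : ℕ) : Type _ :=
  L ⧸ (nsmulAddMonoidHom (α := L) q).range

/-- The natural projection `π_q : L → L / qL`. -/
def projQ (L : AddSubgroup E) (q : ℕ) (x : L) : ModQ L q :=
  QuotientAddGroup.mk x

/-- `M(Φ, L; q)`: the classes `π_q(x)`, `x ∈ L`, with `(β, x) ≢ 0 (mod q)` for all `β ∈ Φ`.
As `Φ = -Φ` for a root system, it does not matter whether `β` runs over all roots or over the
positive roots. -/
def complementModQ (Φ : Set E) (L : AddSubgroup E) (q : ℕ) : Set (ModQ L q) :=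
  {p | ∃ x : L, projQ L q x = p ∧ ∀ β ∈ Φ, ¬ ∃ n : ℤ, inner ℝ β (x : E) = (q : ℝ) * (n : ℝ)}

/-- The characteristic quasi-polynomial `q ↦ #M(Φ, L; q)` of `Φ` with respect to `L`. -/
def charQuasi (Φ : Set E) (L : AddSubgroup E) (q : ℕ) : ℕ :=
  (complementModQ Φ L q).ncard

/-- The value at `w` of the permutation character `χ_{Φ,q}` on `M(Φ, Z; q)`, where `Z` is the
coweight lattice of `Φ` and `w` acts by `π_q(x) ↦ π_q(w x)`: the number of points of
`M(Φ, Z; q)` that are fixed by `w`. -/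
def equivCharQuasi (Φ : Set E) (q : ℕ) (w : E ≃ₗᵢ[ℝ] E) : ℕ :=
  {p ∈ complementModQ Φ (coweightLattice Φ) q |
    ∃ x y : coweightLattice Φ, (y : E) = w (x : E) ∧
      projQ (coweightLattice Φ) q x = p ∧ projQ (coweightLattice Φ) q y = p}.ncard

/-- The reflection in the hyperplane orthogonal to `α`. -/
def refl (α : E) : E ≃ₗᵢ[ℝ] E :=
  ((Submodule.span ℝ {α})ᗮ).reflection

variable {ι : Type*}

/-- The group generated by the simple reflections `s_i`, `i ∈ K`; for `K = Set.univ` this is the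
Weyl group. -/
def parabolic (α : ι → E) (K : Set ι) : Subgroup (E ≃ₗᵢ[ℝ] E) :=
  Subgroup.closure ((fun i => refl (α i)) '' K)

/-- The length of `w` with respect to the simple reflections `s_i`, `i ∈ K`. -/
def wordLength (α : ι → E) (K : Set ι) (w : E ≃ₗᵢ[ℝ] E) : ℕ :=
  sInf {n | ∃ l : List ι, (∀ i ∈ l, i ∈ K) ∧ l.length = n ∧
    (l.map (fun i => refl (α i))).prod = w}

def IsLongest (α : ι → E) (K : Set ι) (w : E ≃ₗᵢ[ℝ] E) : Prop :=
  w ∈ parabolic α K ∧ ∀ v ∈ parabolic α K, wordLength α K v ≤ wordLength α K w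

/-- The longest element of the group generated by the simple reflections `s_i`, `i ∈ K`. -/
def longest (α : ι → E) (K : Set ι) : E ≃ₗᵢ[ℝ] E :=
  Classical.epsilon (IsLongest α K)

/-- `ω_j = w_j w_0`, where `w_0` is the longest element of the Weyl group, and `w_j` the longest
element of the Weyl group that corresponds to the simple roots other than `α_j`. -/
def omega (α : ι → E) (j : ι) : E ≃ₗᵢ[ℝ] E :=
  longest α {i | i ≠ j} * longest α Set.univ

/-- The average `x^w` of `x` under the cyclic group generated by `w`. -/
def average (w : E ≃ₗᵢ[ℝ] E) (x : E) : E :=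
  (orderOf w : ℝ)⁻¹ • ∑ t ∈ Finset.Icc 1 (orderOf w), (w ^ t) x

/-- The folding of `Φ` by `w`: the nonzero averages `β^w` of the roots `β`. -/
def folding (Φ : Set E) (w : E ≃ₗᵢ[ℝ] E) : Set E :=
  {y | y ≠ 0 ∧ ∃ β ∈ Φ, average w β = y}

end General

/-- The standard basis vector `e_i` of `ℝ^ℓ`. -/
def stdVec {l : ℕ} (i : Fin l) : EuclideanSpace ℝ (Fin l) :=
  EuclideanSpace.single i (1 : ℝ)

/-- The roots `±(e_i - e_j)`, `±(e_i + e_j)` (`i < j`), `±2 e_k` of the standard `C_ℓ`. -/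
def rootsC (l : ℕ) : Set (EuclideanSpace ℝ (Fin l)) :=
  {v | (∃ i j : Fin l, i < j ∧
      (v = stdVec i - stdVec j ∨ v = -(stdVec i - stdVec j) ∨
        v = stdVec i + stdVec j ∨ v = -(stdVec i + stdVec j))) ∨
    ∃ k : Fin l, v = (2 : ℝ) • stdVec k ∨ v = -((2 : ℝ) • stdVec k)}

/-- The simple roots `e_1 - e_2, …, e_{ℓ-1} - e_ℓ, 2 e_ℓ` of the standard `C_ℓ`. -/
def simpleC (l : ℕ) (i : Fin l) : EuclideanSpace ℝ (Fin l) :=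
  if h : (i : ℕ) + 1 < l then stdVec i - stdVec ⟨(i : ℕ) + 1, h⟩ else (2 : ℝ) • stdVec i

/-- The roots `±(e_i - e_j)`, `±(e_i + e_j)` (`i < j`), `±e_k`, `±2 e_k` of the standard
`BC_m`. -/
def rootsBC (m : ℕ) : Set (EuclideanSpace ℝ (Fin m)) :=
  rootsC m ∪ {v | ∃ k : Fin m, v = stdVec k ∨ v = -stdVec k}

section Types

variable {E : Type*} [NormedAddCommGroup E] [InnerProductSpace ℝ E]

/-- `Φ` is a root system of type `C_ℓ` in `E`, with basis `α_1, …, α_ℓ` in the usual numbering: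
a similarity from `ℝ^ℓ` onto `E` takes the standard `C_ℓ` to `Φ` and its simple roots, in order,
to `α_1, …, α_ℓ`. -/
def IsTypeC (l : ℕ) (Φ : Set E) (α : Fin l → E) : Prop :=
  ∃ (c : ℝ) (φ : EuclideanSpace ℝ (Fin l) ≃ₗᵢ[ℝ] E), 0 < c ∧
    Φ = (fun v => c • φ v) '' rootsC l ∧ ∀ i, α i = c • φ (simpleC l i)

/-- `Ψ` is a root system of type `BC_m` in the subspace of `E` that it spans. -/
def IsTypeBC (m : ℕ) (Ψ : Set E) : Prop :=
  ∃ (c : ℝ) (φ : EuclideanSpace ℝ (Fin m) →ₗᵢ[ℝ] E), 0 < c ∧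
    Ψ = (fun v => c • φ v) '' rootsBC m

end Types

end RootChar

end

open RootChar

/-!
On an orthogonal frame `v` with `Φ = {±v i ± v j, ±2 v k}`, the inner products with `v` identify
the coweight lattice with the tuples all of whose entries lie in `ℤ`, or all in `ℤ + 1/2`. Writing
such a tuple as `u + t / 2` with integral `u` and `t`, a class modulo `q` is regular when no
`u i - u j` (`i ≠ j`) and no `u i + u j + t` vanishes in `ℤ/q`. The pair `(u, t)` is only determined
up to `(u + s, t - 2 s)`, so the number of regular classes is the average over all `t` of the number
of regular `u`; for fixed `t` these are the tuples that are injective modulo `a ↦ -a - t` and avoid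
its fixed points.

The length of an element of the Weyl group is its number of inversions, so `w_0 = -1`, and the
longest element of the symmetric group reverses the frame; thus `ω_ℓ` is `v k ↦ -v (rev k)`. When
`ℓ` is odd and `q` is even, a regular class that `ω_ℓ` fixes is given by `(u, t)` with `u` odd under
`rev` and `t` the element of order two of `ℤ/q`. Such a pair is regular exactly when no `2 (a ± b)`
vanishes for the values `a`, `b` of `u` on half of the indices, which is the condition imposed by
`2 Φ_re`.
-/

namespace RootChar

section Families

variable {ι A B : Type*} [AddCommGroup A] [AddCommGroup B]

/-- The vectors `±(v i - v j)` (`i ≠ j`) and `±(v i + v j)`: for an orthogonal family `v` of vectors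
of equal length they form a root system of type `C`. The long roots `±2 v i` are the sums with
`i = j`. -/
def typeCRoots (v : ι → A) : Set A :=
  {β | (∃ i j, i ≠ j ∧ β = v i - v j) ∨ ∃ i j, β = v i + v j ∨ β = -(v i + v j)}

/-- The roots `typeCRoots v` together with the short roots `±v i` of a root system of type `BC`. -/
def typeBCRoots (v : ι → A) : Set A :=
  typeCRoots v ∪ {β | ∃ i, β = v i ∨ β = -v i}

variable {v : ι → A}

theorem sub_mem_typeCRoots {i j : ι} (hij : i ≠ j) : v i - v j ∈ typeCRoots v :=
  Or.inl ⟨i, j, hij, rfl⟩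

theorem add_mem_typeCRoots (i j : ι) : v i + v j ∈ typeCRoots v :=
  Or.inr ⟨i, j, Or.inl rfl⟩

theorem neg_mem_typeCRoots {β : A} (hβ : β ∈ typeCRoots v) : -β ∈ typeCRoots v := by
  obtain ⟨i, j, hij, rfl⟩ | ⟨i, j, rfl | rfl⟩ := hβ
  · exact neg_sub (v i) (v j) ▸ sub_mem_typeCRoots hij.symm
  · exact Or.inr ⟨i, j, Or.inr rfl⟩
  · exact (neg_neg (v i + v j)).symm ▸ add_mem_typeCRoots i j

theorem mem_typeBCRoots (i : ι) : v i ∈ typeBCRoots v :=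
  Or.inr ⟨i, Or.inl rfl⟩

theorem forall_typeCRoots {p : A → Prop} (hp : ∀ β, p β → p (-β)) :
    (∀ β ∈ typeCRoots v, p β) ↔ (∀ i j, i ≠ j → p (v i - v j)) ∧ ∀ i j, p (v i + v j) := by
  refine ⟨fun h => ⟨fun i j hij => h _ (sub_mem_typeCRoots hij),
    fun i j => h _ (add_mem_typeCRoots i j)⟩, ?_⟩
  rintro ⟨hsub, hadd⟩ β (⟨i, j, hij, rfl⟩ | ⟨i, j, rfl | rfl⟩)
  · exact hsub i j hij
  · exact hadd i j
  · exact hp _ (hadd i j)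

theorem forall_typeBCRoots {p : A → Prop} (hp : ∀ β, p β → p (-β)) :
    (∀ β ∈ typeBCRoots v, p β) ↔ (∀ β ∈ typeCRoots v, p β) ∧ ∀ i, p (v i) := by
  refine ⟨fun h => ⟨fun β hβ => h β (Or.inl hβ), fun i => h _ (mem_typeBCRoots i)⟩, ?_⟩
  rintro ⟨hC, hv⟩ β (hβ | ⟨i, rfl | rfl⟩)
  · exact hC β hβ
  · exact hv i
  · exact hp _ (hv i)

theorem image_typeCRoots (f : A →+ B) (v : ι → A) :
    f '' typeCRoots v = typeCRoots fun i => f (v i) := by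
  ext γ
  constructor
  · rintro ⟨_, ⟨i, j, hij, rfl⟩ | ⟨i, j, rfl | rfl⟩, rfl⟩
    · exact Or.inl ⟨i, j, hij, map_sub f _ _⟩
    · exact Or.inr ⟨i, j, Or.inl (map_add f _ _)⟩
    · exact Or.inr ⟨i, j, Or.inr (by rw [map_neg, map_add])⟩
  · rintro (⟨i, j, hij, rfl⟩ | ⟨i, j, rfl | rfl⟩)
    · exact ⟨_, sub_mem_typeCRoots hij, map_sub f _ _⟩
    · exact ⟨_, add_mem_typeCRoots i j, map_add f _ _⟩
    · exact ⟨_, Or.inr ⟨i, j, Or.inr rfl⟩, by rw [map_neg, map_add]⟩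

theorem image_typeBCRoots (f : A →+ B) (v : ι → A) :
    f '' typeBCRoots v = typeBCRoots fun i => f (v i) := by
  rw [typeBCRoots, Set.image_union, image_typeCRoots, typeBCRoots]
  congr 1
  ext γ
  constructor
  · rintro ⟨_, ⟨i, rfl | rfl⟩, rfl⟩
    · exact ⟨i, Or.inl rfl⟩
    · exact ⟨i, Or.inr (map_neg f _)⟩
  · rintro ⟨i, rfl | rfl⟩
    · exact ⟨_, ⟨i, Or.inl rfl⟩, rfl⟩
    · exact ⟨_, ⟨i, Or.inr rfl⟩, map_neg f _⟩

end Families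

theorem rootsC_eq_typeCRoots (l : ℕ) : rootsC l = typeCRoots stdVec := by
  ext β
  simp only [rootsC, typeCRoots, two_smul, Set.mem_ofPred_eq]
  constructor
  · rintro (⟨i, j, hij, h | h | h | h⟩ | ⟨k, h⟩)
    · exact Or.inl ⟨i, j, hij.ne, h⟩
    · exact Or.inl ⟨j, i, hij.ne', h.trans (neg_sub _ _)⟩
    · exact Or.inr ⟨i, j, Or.inl h⟩
    · exact Or.inr ⟨i, j, Or.inr h⟩
    · exact Or.inr ⟨k, k, h⟩
  · rintro (⟨i, j, hij, h⟩ | ⟨i, j, h⟩)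
    · rcases hij.lt_or_gt with hlt | hlt
      · exact Or.inl ⟨i, j, hlt, Or.inl h⟩
      · exact Or.inl ⟨j, i, hlt, Or.inr (Or.inl (h.trans (neg_sub _ _).symm))⟩
    · rcases lt_trichotomy i j with hlt | rfl | hlt
      · exact Or.inl ⟨i, j, hlt, Or.inr (Or.inr h)⟩
      · exact Or.inr ⟨i, h⟩
      · rw [add_comm] at h
        exact Or.inl ⟨j, i, hlt, Or.inr (Or.inr h)⟩

theorem rootsBC_eq_typeBCRoots (m : ℕ) : rootsBC m = typeBCRoots stdVec := by
  rw [rootsBC, rootsC_eq_typeCRoots, typeBCRoots]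

section Frames

variable {E : Type*} [NormedAddCommGroup E] [InnerProductSpace ℝ E] {ι : Type*}

/-- The vectors `v i` are pairwise orthogonal and have the same squared length `d`. Working with
frames rather than orthonormal bases lets the similarity in `IsTypeC` be absorbed into `v`. -/
structure IsOrthogonalFrame (d : ℝ) (v : ι → E) : Prop where
  pos : 0 < d
  inner_self : ∀ i, inner ℝ (v i) (v i) = d
  inner_ne : ∀ i j, i ≠ j → inner ℝ (v i) (v j) = 0

/-- The combination of the vectors of a frame that has inner product `a k` with `v k`. -/
noncomputable def dualVec [Fintype ι] (d : ℝ) (v : ι → E) (a : ι → ℝ) : E :=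
  ∑ k, (a k / d) • v k

theorem dualVec_mem_span [Fintype ι] (d : ℝ) (v : ι → E) (a : ι → ℝ) :
    dualVec d v a ∈ Submodule.span ℝ (Set.range v) :=
  Submodule.sum_mem _ fun k _ => Submodule.smul_mem _ _ (Submodule.subset_span ⟨k, rfl⟩)

theorem eq_zero_of_mem_span_of_inner_eq_zero {v : ι → E} {x : E}
    (hx : x ∈ Submodule.span ℝ (Set.range v)) (h0 : ∀ k, inner ℝ (v k) x = 0) : x = 0 := by
  have hle : Submodule.span ℝ (Set.range v) ≤ (Submodule.span ℝ {x})ᗮ := by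
    rw [Submodule.span_le]
    rintro _ ⟨k, rfl⟩
    exact Submodule.mem_orthogonal_singleton_iff_inner_left.2 (h0 k)
  exact inner_self_eq_zero.1 (Submodule.mem_orthogonal_singleton_iff_inner_left.1 (hle hx))

namespace IsOrthogonalFrame

variable {d : ℝ} {v : ι → E}

theorem inner_dualVec [Fintype ι] (h : IsOrthogonalFrame d v) (a : ι → ℝ) (k : ι) :
    inner ℝ (v k) (dualVec d v a) = a k := by
  rw [dualVec, inner_sum, Finset.sum_eq_single k, inner_smul_right, h.inner_self,
    div_mul_cancel₀ _ h.pos.ne']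
  · intro i _ hik
    rw [inner_smul_right, h.inner_ne k i hik.symm, mul_zero]
  · exact fun hk => absurd (Finset.mem_univ k) hk

theorem norm_eq (h : IsOrthogonalFrame d v) (i : ι) : ‖v i‖ = √d := by
  rw [← h.inner_self i, real_inner_self_eq_norm_sq, Real.sqrt_sq (norm_nonneg _)]

theorem smul (h : IsOrthogonalFrame d v) {c : ℝ} (hc : 0 < c) :
    IsOrthogonalFrame (c ^ 2 * d) fun i => c • v i where
  pos := mul_pos (pow_pos hc 2) h.pos
  inner_self i := by
    rw [inner_smul_left, inner_smul_right, h.inner_self, conj_trivial]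
    ring
  inner_ne i j hij := by
    rw [inner_smul_left, inner_smul_right, h.inner_ne i j hij, mul_zero, mul_zero]

theorem map {F : Type*} [NormedAddCommGroup F] [InnerProductSpace ℝ F]
    (h : IsOrthogonalFrame d v) (φ : E →ₗᵢ[ℝ] F) : IsOrthogonalFrame d fun i => φ (v i) where
  pos := h.pos
  inner_self i := by rw [φ.inner_map_map, h.inner_self]
  inner_ne i j hij := by rw [φ.inner_map_map, h.inner_ne i j hij]

end IsOrthogonalFrame

theorem stdVec_isOrthogonalFrame (l : ℕ) : IsOrthogonalFrame 1 (stdVec (l := l)) where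
  pos := one_pos
  inner_self i := by simp [stdVec]
  inner_ne i j hij := by simp [stdVec, EuclideanSpace.inner_single_left, hij]

end Frames

section Longest

variable {E : Type*} [NormedAddCommGroup E] [InnerProductSpace ℝ E] {ι : Type*}

theorem refl_self (a : E) : refl a a = -a :=
  Submodule.reflection_orthogonalComplement_singleton_eq_neg a

theorem refl_refl (a x : E) : refl a (refl a x) = x :=
  Submodule.reflection_reflection _ x

theorem refl_mul_self (a : E) : refl a * refl a = 1 :=
  LinearIsometryEquiv.ext (refl_refl a)

theorem refl_eq_self {a x : E} (h : inner ℝ a x = 0) : refl a x = x :=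
  Submodule.reflection_mem_subspace_eq_self
    (Submodule.mem_orthogonal_singleton_iff_inner_right.2 h)

theorem refl_add_self (a : E) : refl (a + a) = refl a := by
  simp only [← two_smul ℝ a, refl,
    Submodule.span_singleton_smul_eq (IsUnit.mk0 (2 : ℝ) two_ne_zero)]

theorem refl_mem_parabolic (α : ι → E) {K : Set ι} {i : ι} (hi : i ∈ K) :
    refl (α i) ∈ parabolic α K :=
  Subgroup.subset_closure ⟨i, hi, rfl⟩

theorem prod_map_refl_mem_parabolic (α : ι → E) {K : Set ι} (t : List ι) (ht : ∀ i ∈ t, i ∈ K) :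
    (t.map fun i => refl (α i)).prod ∈ parabolic α K := by
  refine list_prod_mem fun x hx => ?_
  obtain ⟨i, hi, rfl⟩ := List.mem_map.1 hx
  exact refl_mem_parabolic α (ht i hi)

theorem parabolic_induction {α : ι → E} {K : Set ι} {p : (E ≃ₗᵢ[ℝ] E) → Prop} (h1 : p 1)
    (hmul : ∀ i ∈ K, ∀ w, p w → p (refl (α i) * w)) {w : E ≃ₗᵢ[ℝ] E}
    (hw : w ∈ parabolic α K) : p w := by
  induction hw using Subgroup.closure_induction_left with
  | one => exact h1
  | mul_left s hs y _ ih =>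
    obtain ⟨i, hi, rfl⟩ := hs
    exact hmul i hi y ih
  | inv_mul_cancel s hs y _ ih =>
    obtain ⟨i, hi, rfl⟩ := hs
    have hinv : (refl (α i))⁻¹ = refl (α i) := inv_eq_of_mul_eq_one_left (refl_mul_self _)
    simpa only [hinv] using hmul i hi y ih

/-- The vectors of `P` that `w` maps to `-P`. If `P` is a set of positive roots, their number is
the length of `w`. -/
def inversions (P : Set E) (w : E ≃ₗᵢ[ℝ] E) : Set E := {β | β ∈ P ∧ -(w β) ∈ P}

theorem inversions_subset (P : Set E) (w : E ≃ₗᵢ[ℝ] E) : inversions P w ⊆ P := fun _ hβ => hβ.1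

/-- The properties of the set `P` of positive roots of a root system with simple roots `α i`,
`i ∈ K`, that determine lengths and longest elements in the group generated by the reflections
in the `α i`. -/
structure IsPositiveSystem (α : ι → E) (K : Set ι) (P : Set E) : Prop where
  finite : P.Finite
  neg_notMem : ∀ β ∈ P, -β ∉ P
  simple_mem : ∀ i ∈ K, α i ∈ P
  refl_mem : ∀ i ∈ K, ∀ β ∈ P, β ≠ α i → refl (α i) β ∈ P
  eq_one : ∀ w ∈ parabolic α K, (∀ i ∈ K, w (α i) ∈ P) → w = 1

namespace IsPositiveSystem

variable {α : ι → E} {K : Set ι} {P : Set E}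

theorem refl_mem_or (h : IsPositiveSystem α K P) {i : ι} (hi : i ∈ K) {β : E}
    (hβ : β ∈ P ∨ -β ∈ P) : refl (α i) β ∈ P ∨ -(refl (α i) β) ∈ P := by
  have of_mem : ∀ γ ∈ P, refl (α i) γ ∈ P ∨ -(refl (α i) γ) ∈ P := by
    intro γ hγ
    by_cases hγi : γ = α i
    · right
      rw [hγi, refl_self, neg_neg]
      exact h.simple_mem i hi
    · exact Or.inl (h.refl_mem i hi γ hγ hγi)
  rcases hβ with hβ | hβ
  · exact of_mem β hβ
  · simpa only [map_neg, neg_neg, or_comm] using of_mem (-β) hβ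

theorem map_simple_mem_or (h : IsPositiveSystem α K P) {w : E ≃ₗᵢ[ℝ] E} (hw : w ∈ parabolic α K)
    {i : ι} (hi : i ∈ K) : w (α i) ∈ P ∨ -(w (α i)) ∈ P :=
  parabolic_induction (p := fun w => w (α i) ∈ P ∨ -(w (α i)) ∈ P) (Or.inl (h.simple_mem i hi))
    (fun _ hj _ ih => h.refl_mem_or hj ih) hw

theorem finite_inversions (h : IsPositiveSystem α K P) (w : E ≃ₗᵢ[ℝ] E) :
    (inversions P w).Finite :=
  h.finite.subset (inversions_subset P w)

theorem inversions_one (h : IsPositiveSystem α K P) : inversions P (1 : E ≃ₗᵢ[ℝ] E) = ∅ :=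
  Set.eq_empty_of_forall_notMem fun β hβ => h.neg_notMem β hβ.1 hβ.2

theorem image_refl_inversions_mul_refl (h : IsPositiveSystem α K P) {i : ι} (hi : i ∈ K)
    {w : E ≃ₗᵢ[ℝ] E} (hw : -(w (α i)) ∈ P) :
    refl (α i) '' inversions P (w * refl (α i)) = inversions P w \ {α i} := by
  ext β
  constructor
  · rintro ⟨γ, ⟨hγ, hwγ⟩, rfl⟩
    rw [LinearIsometryEquiv.coe_mul, Function.comp_apply] at hwγ
    have hne : γ ≠ α i := by
      rintro rfl
      rw [refl_self, map_neg, neg_neg] at hwγ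
      exact h.neg_notMem _ hwγ hw
    refine ⟨⟨h.refl_mem i hi γ hγ hne, hwγ⟩, fun hrefl : refl (α i) γ = α i => ?_⟩
    have hγ_eq : γ = -α i := by rw [← refl_refl (α i) γ, hrefl, refl_self]
    exact h.neg_notMem _ (h.simple_mem i hi) (hγ_eq ▸ hγ)
  · rintro ⟨⟨hβ, hwβ⟩, hne⟩
    refine ⟨refl (α i) β, ⟨h.refl_mem i hi β hβ hne, ?_⟩, refl_refl _ _⟩
    rwa [LinearIsometryEquiv.coe_mul, Function.comp_apply, refl_refl]

theorem ncard_inversions_of_neg (h : IsPositiveSystem α K P) {i : ι} (hi : i ∈ K)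
    {w : E ≃ₗᵢ[ℝ] E} (hw : -(w (α i)) ∈ P) :
    (inversions P (w * refl (α i))).ncard + 1 = (inversions P w).ncard := by
  have hmem : α i ∈ inversions P w := ⟨h.simple_mem i hi, hw⟩
  rw [← Set.ncard_sdiff_singleton_add_one hmem (h.finite_inversions w),
    ← h.image_refl_inversions_mul_refl hi hw, Set.ncard_image_of_injective _ (refl (α i)).injective]

theorem ncard_inversions_of_pos (h : IsPositiveSystem α K P) {i : ι} (hi : i ∈ K)
    {w : E ≃ₗᵢ[ℝ] E} (hw : w (α i) ∈ P) :
    (inversions P (w * refl (α i))).ncard = (inversions P w).ncard + 1 := by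
  have hneg : -((w * refl (α i)) (α i)) ∈ P := by
    rwa [LinearIsometryEquiv.coe_mul, Function.comp_apply, refl_self, map_neg, neg_neg]
  rw [← h.ncard_inversions_of_neg hi hneg, mul_assoc, refl_mul_self, mul_one]

theorem exists_word (h : IsPositiveSystem α K P) {w : E ≃ₗᵢ[ℝ] E} (hw : w ∈ parabolic α K) :
    ∃ t : List ι, (∀ i ∈ t, i ∈ K) ∧ t.length = (inversions P w).ncard ∧
      (t.map fun i => refl (α i)).prod = w := by
  generalize hn : (inversions P w).ncard = n
  induction n generalizing w with
  | zero =>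
    have hempty : inversions P w = ∅ := (Set.ncard_eq_zero (h.finite_inversions w)).1 hn
    have hw1 : w = 1 := h.eq_one w hw fun i hi =>
      (h.map_simple_mem_or hw hi).resolve_right fun hneg =>
        Set.eq_empty_iff_forall_notMem.1 hempty (α i) ⟨h.simple_mem i hi, hneg⟩
    exact ⟨[], by simp, rfl, hw1.symm⟩
  | succ n ih =>
    obtain ⟨i, hi, hwi⟩ : ∃ i ∈ K, -(w (α i)) ∈ P := by
      by_contra! hcon
      rw [h.eq_one w hw fun i hi => (h.map_simple_mem_or hw hi).resolve_right (hcon i hi),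
        h.inversions_one, Set.ncard_empty] at hn
      exact n.succ_ne_zero hn.symm
    obtain ⟨t, ht, hlen, hprod⟩ := ih (mul_mem hw (refl_mem_parabolic α hi))
      (Nat.succ_injective ((h.ncard_inversions_of_neg hi hwi).trans hn))
    refine ⟨t ++ [i], fun k hk => ?_, by rw [List.length_append, hlen, List.length_singleton], ?_⟩
    · rcases List.mem_append.1 hk with hk | hk
      · exact ht k hk
      · exact List.mem_singleton.1 hk ▸ hi
    · rw [List.map_append, List.prod_append, hprod, List.map_singleton, List.prod_singleton,
        mul_assoc, refl_mul_self, mul_one]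

theorem ncard_inversions_le_length (h : IsPositiveSystem α K P) (t : List ι)
    (ht : ∀ i ∈ t, i ∈ K) :
    (inversions P (t.map fun i => refl (α i)).prod).ncard ≤ t.length := by
  induction t using List.reverseRecOn with
  | nil => simp [h.inversions_one]
  | append_singleton t i ih =>
    have ht' : ∀ k ∈ t, k ∈ K := fun k hk => ht k (List.mem_append_left _ hk)
    have hi : i ∈ K := ht i (by simp)
    have hle := ih ht'
    rw [List.map_append, List.prod_append, List.length_append, List.map_singleton,
      List.prod_singleton, List.length_singleton]
    rcases h.map_simple_mem_or (prod_map_refl_mem_parabolic α t ht') hi with hpos | hneg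
    · rw [h.ncard_inversions_of_pos hi hpos]
      exact Nat.succ_le_succ hle
    · have hcard := h.ncard_inversions_of_neg hi hneg
      omega

theorem wordLength_eq (h : IsPositiveSystem α K P) {w : E ≃ₗᵢ[ℝ] E}
    (hw : w ∈ parabolic α K) : wordLength α K w = (inversions P w).ncard := by
  refine le_antisymm (Nat.sInf_le (h.exists_word hw)) (le_csInf ⟨_, h.exists_word hw⟩ ?_)
  rintro _ ⟨t, ht, rfl, rfl⟩
  exact h.ncard_inversions_le_length t ht

theorem isLongest_longest (h : IsPositiveSystem α K P) : IsLongest α K (longest α K) := by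
  refine Classical.epsilon_spec (p := IsLongest α K) ?_
  let S : Set ℕ := wordLength α K '' (parabolic α K : Set (E ≃ₗᵢ[ℝ] E))
  have hbdd : BddAbove S := ⟨P.ncard, by
    rintro _ ⟨w, hw, rfl⟩
    rw [h.wordLength_eq hw]
    exact Set.ncard_le_ncard (inversions_subset P w) h.finite⟩
  obtain ⟨w, hw, hwS⟩ := Nat.sSup_mem (s := S) ⟨_, 1, one_mem _, rfl⟩ hbdd
  exact ⟨w, hw, fun v hv => hwS ▸ le_csSup hbdd ⟨v, hv, rfl⟩⟩

theorem longest_mem_parabolic (h : IsPositiveSystem α K P) : longest α K ∈ parabolic α K :=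
  h.isLongest_longest.1

theorem neg_longest_simple_mem (h : IsPositiveSystem α K P) :
    ∀ i ∈ K, -(longest α K (α i)) ∈ P := by
  intro i hi
  obtain ⟨hmem, hmax⟩ := h.isLongest_longest
  refine (h.map_simple_mem_or hmem hi).resolve_left fun hpos => ?_
  have hmem' := mul_mem hmem (refl_mem_parabolic α hi)
  have hle := hmax _ hmem'
  rw [h.wordLength_eq hmem', h.wordLength_eq hmem, h.ncard_inversions_of_pos hi hpos] at hle
  exact absurd hle (Nat.not_succ_le_self _)

end IsPositiveSystem

end Longest

section PositiveRoots

variable {A : Type*} [AddCommGroup A] {n : ℕ}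

/-- The simple roots `v_k - v_{k+1}` and `2 v_n` of the root system `typeCRoots v`, for a family
`v_0, …, v_n`. -/
def simpleRootsC (v : Fin (n + 1) → A) : Fin (n + 1) → A :=
  Fin.lastCases (motive := fun _ => A) (v (Fin.last n) + v (Fin.last n))
    fun k => v k.castSucc - v k.succ

/-- The positive roots `v i - v j`, `i < j`, of type `A`. -/
def posRootsA (v : Fin (n + 1) → A) : Set A :=
  {β | ∃ i j, i < j ∧ β = v i - v j}

/-- The positive roots `v i - v j`, `i < j`, and `v i + v j` of `typeCRoots v`. -/
def posRootsC (v : Fin (n + 1) → A) : Set A :=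
  posRootsA v ∪ {β | ∃ i j, β = v i + v j}

variable {v : Fin (n + 1) → A}

theorem simpleRootsC_castSucc (k : Fin n) :
    simpleRootsC v k.castSucc = v k.castSucc - v k.succ :=
  Fin.lastCases_castSucc k

theorem simpleRootsC_last : simpleRootsC v (Fin.last n) = v (Fin.last n) + v (Fin.last n) :=
  Fin.lastCases_last

theorem finite_posRootsA (v : Fin (n + 1) → A) : (posRootsA v).Finite := by
  refine (Set.finite_range fun p : Fin (n + 1) × Fin (n + 1) => v p.1 - v p.2).subset ?_
  rintro β ⟨i, j, -, rfl⟩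
  exact ⟨(i, j), rfl⟩

theorem finite_posRootsC (v : Fin (n + 1) → A) : (posRootsC v).Finite := by
  refine (finite_posRootsA v).union
    ((Set.finite_range fun p : Fin (n + 1) × Fin (n + 1) => v p.1 + v p.2).subset ?_)
  rintro β ⟨i, j, rfl⟩
  exact ⟨(i, j), rfl⟩

theorem simpleRootsC_castSucc_mem_posRootsA (k : Fin n) :
    simpleRootsC v k.castSucc ∈ posRootsA v :=
  ⟨_, _, Fin.castSucc_lt_succ, simpleRootsC_castSucc k⟩

theorem simpleRootsC_mem_posRootsC (i : Fin (n + 1)) : simpleRootsC v i ∈ posRootsC v := by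
  induction i using Fin.lastCases with
  | last => exact Or.inr ⟨_, _, simpleRootsC_last⟩
  | cast k => exact Or.inl (simpleRootsC_castSucc_mem_posRootsA k)

end PositiveRoots

theorem swap_castSucc_succ_lt {n : ℕ} {k : Fin n} {i j : Fin (n + 1)} (hij : i < j)
    (hne : ¬(i = k.castSucc ∧ j = k.succ)) :
    Equiv.swap k.castSucc k.succ i < Equiv.swap k.castSucc k.succ j := by
  simp only [Equiv.swap_apply_def]
  split_ifs <;> simp only [Fin.ext_iff, Fin.lt_def, Fin.val_castSucc, Fin.val_succ] at * <;> omega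

theorem forall_ne_last {n : ℕ} {p : Fin (n + 1) → Prop} :
    (∀ i ∈ {i | i ≠ Fin.last n}, p i) ↔ ∀ k : Fin n, p k.castSucc := by
  simp only [Fin.forall_fin_succ', Set.mem_ofPred_eq, ne_eq, not_true_eq_false, false_imp_iff,
    and_true, (Fin.castSucc_lt_last _).ne, not_false_eq_true, true_imp_iff]

section TypeC

variable {E : Type*} [NormedAddCommGroup E] [InnerProductSpace ℝ E] {n : ℕ}

theorem linearIsometryEquiv_ext_of_span_eq_top {ι : Type*} {v : ι → E}
    (hspan : Submodule.span ℝ (Set.range v) = ⊤) {w w' : E ≃ₗᵢ[ℝ] E}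
    (h : ∀ k, w (v k) = w' (v k)) : w = w' := by
  have hlin : (w.toLinearEquiv : E →ₗ[ℝ] E) = w'.toLinearEquiv :=
    LinearMap.ext_on_range hspan h
  ext x
  exact LinearMap.congr_fun hlin x

section Frame

variable {ι : Type*} [DecidableEq ι] {d : ℝ} {v : ι → E}

theorem IsOrthogonalFrame.refl_sub_apply (h : IsOrthogonalFrame d v) (i j k : ι) :
    refl (v i - v j) (v k) = v (Equiv.swap i j k) := by
  have hij : refl (v i - v j) (v i) = v j :=
    Submodule.reflection_sub ((h.norm_eq i).trans (h.norm_eq j).symm)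
  rw [Equiv.swap_apply_def]
  split_ifs with hki hkj
  · rw [hki, hij]
  · rw [hkj]
    nth_rewrite 2 [← hij]
    exact refl_refl _ _
  · refine refl_eq_self ?_
    rw [inner_sub_left, h.inner_ne i k (Ne.symm hki), h.inner_ne j k (Ne.symm hkj), sub_zero]

theorem IsOrthogonalFrame.refl_add_self_apply (h : IsOrthogonalFrame d v) (i k : ι) :
    refl (v i + v i) (v k) = if k = i then -v k else v k := by
  rw [refl_add_self]
  split_ifs with hki
  · rw [hki, refl_self]
  · exact refl_eq_self (h.inner_ne i k (Ne.symm hki))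

end Frame

variable {v : Fin (n + 1) → E}

/-- A vector whose inner products with the `v k` decrease to `1`. -/
noncomputable def heightVec (d : ℝ) (v : Fin (n + 1) → E) : E :=
  dualVec d v fun k => (n : ℝ) + 1 - (k : ℕ)

namespace IsOrthogonalFrame

variable {d : ℝ}

theorem inner_heightVec (h : IsOrthogonalFrame d v) (k : Fin (n + 1)) :
    inner ℝ (v k) (heightVec d v) = (n : ℝ) + 1 - (k : ℕ) :=
  h.inner_dualVec _ k

theorem inner_heightVec_pos (h : IsOrthogonalFrame d v) (k : Fin (n + 1)) :
    0 < inner ℝ (v k) (heightVec d v) := by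
  have hk : ((k : ℕ) : ℝ) < (n : ℝ) + 1 := by exact_mod_cast k.2
  rw [h.inner_heightVec]
  linarith

theorem inner_heightVec_lt_iff (h : IsOrthogonalFrame d v) {i j : Fin (n + 1)} :
    inner ℝ (v j) (heightVec d v) < inner ℝ (v i) (heightVec d v) ↔ i < j := by
  rw [h.inner_heightVec, h.inner_heightVec, sub_lt_sub_iff_left, Nat.cast_lt, Fin.lt_def]

theorem inner_heightVec_pos_of_mem (h : IsOrthogonalFrame d v) {β : E} (hβ : β ∈ posRootsC v) :
    0 < inner ℝ β (heightVec d v) := by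
  rcases hβ with ⟨i, j, hij, rfl⟩ | ⟨i, j, rfl⟩
  · rw [inner_sub_left]
    exact sub_pos.2 (h.inner_heightVec_lt_iff.2 hij)
  · rw [inner_add_left]
    exact add_pos (h.inner_heightVec_pos i) (h.inner_heightVec_pos j)

theorem neg_notMem_posRootsC (h : IsOrthogonalFrame d v) {β : E} (hβ : β ∈ posRootsC v) :
    -β ∉ posRootsC v := fun hneg => by
  have hpos := h.inner_heightVec_pos_of_mem hneg
  rw [inner_neg_left] at hpos
  exact (neg_pos.1 hpos).not_gt (h.inner_heightVec_pos_of_mem hβ)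

theorem lt_of_sub_mem_posRootsC (h : IsOrthogonalFrame d v) {i j : Fin (n + 1)}
    (hij : v i - v j ∈ posRootsC v) : i < j := by
  have hpos := h.inner_heightVec_pos_of_mem hij
  rw [inner_sub_left, sub_pos] at hpos
  exact h.inner_heightVec_lt_iff.1 hpos

theorem refl_castSucc_apply (h : IsOrthogonalFrame d v) (k : Fin n) (i : Fin (n + 1)) :
    refl (simpleRootsC v k.castSucc) (v i) = v (Equiv.swap k.castSucc k.succ i) := by
  rw [simpleRootsC_castSucc, h.refl_sub_apply]

theorem refl_last_apply (h : IsOrthogonalFrame d v) (i : Fin (n + 1)) :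
    refl (simpleRootsC v (Fin.last n)) (v i) = if i = Fin.last n then -v i else v i := by
  rw [simpleRootsC_last, h.refl_add_self_apply]

theorem refl_castSucc_mem_posRootsA (h : IsOrthogonalFrame d v) (k : Fin n) {β : E}
    (hβ : β ∈ posRootsA v) (hne : β ≠ simpleRootsC v k.castSucc) :
    refl (simpleRootsC v k.castSucc) β ∈ posRootsA v := by
  obtain ⟨i, j, hij, rfl⟩ := hβ
  refine ⟨_, _, swap_castSucc_succ_lt (k := k) hij ?_, ?_⟩
  · rintro ⟨rfl, rfl⟩
    exact hne (simpleRootsC_castSucc k).symm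
  · rw [map_sub, h.refl_castSucc_apply, h.refl_castSucc_apply]

theorem refl_castSucc_mem_posRootsC (h : IsOrthogonalFrame d v) (k : Fin n) {β : E}
    (hβ : β ∈ posRootsC v) (hne : β ≠ simpleRootsC v k.castSucc) :
    refl (simpleRootsC v k.castSucc) β ∈ posRootsC v := by
  rcases hβ with hβ | ⟨i, j, rfl⟩
  · exact Or.inl (h.refl_castSucc_mem_posRootsA k hβ hne)
  · rw [map_add, h.refl_castSucc_apply, h.refl_castSucc_apply]
    exact Or.inr ⟨_, _, rfl⟩

theorem refl_last_mem_posRootsC (h : IsOrthogonalFrame d v) {β : E} (hβ : β ∈ posRootsC v)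
    (hne : β ≠ simpleRootsC v (Fin.last n)) :
    refl (simpleRootsC v (Fin.last n)) β ∈ posRootsC v := by
  rcases hβ with ⟨i, j, hij, rfl⟩ | ⟨i, j, rfl⟩
  · rw [map_sub, h.refl_last_apply, h.refl_last_apply, if_neg (hij.trans_le (Fin.le_last j)).ne]
    split_ifs
    · exact Or.inr ⟨i, j, sub_neg_eq_add _ _⟩
    · exact Or.inl ⟨i, j, hij, rfl⟩
  · rw [map_add, h.refl_last_apply, h.refl_last_apply]
    split_ifs with hi hj hj
    · exact absurd (by rw [hi, hj, simpleRootsC_last]) hne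
    · exact Or.inl ⟨j, i, hi ▸ lt_of_le_of_ne (Fin.le_last j) hj, neg_add_eq_sub _ _⟩
    · exact Or.inl ⟨i, j, hj ▸ lt_of_le_of_ne (Fin.le_last i) hi, (sub_eq_add_neg _ _).symm⟩
    · exact Or.inr ⟨i, j, rfl⟩

theorem exists_apply_eq_of_mem_parabolic_ne_last (h : IsOrthogonalFrame d v) {w : E ≃ₗᵢ[ℝ] E}
    (hw : w ∈ parabolic (simpleRootsC v) {i | i ≠ Fin.last n}) :
    ∃ τ : Fin (n + 1) → Fin (n + 1), ∀ k, w (v k) = v (τ k) := by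
  refine parabolic_induction (p := fun w => ∃ τ : Fin (n + 1) → Fin (n + 1),
    ∀ k, w (v k) = v (τ k)) ⟨id, fun _ => rfl⟩ (forall_ne_last.2 ?_) hw
  rintro i w ⟨τ, hτ⟩
  exact ⟨fun k => Equiv.swap i.castSucc i.succ (τ k), fun k => by
    rw [LinearIsometryEquiv.coe_mul, Function.comp_apply, hτ, h.refl_castSucc_apply]⟩

theorem apply_eq_or_neg_of_mem_parabolic (h : IsOrthogonalFrame d v) {w : E ≃ₗᵢ[ℝ] E}
    (hw : w ∈ parabolic (simpleRootsC v) Set.univ) (k : Fin (n + 1)) :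
    ∃ i, w (v k) = v i ∨ w (v k) = -v i := by
  refine parabolic_induction (p := fun w => ∃ i, w (v k) = v i ∨ w (v k) = -v i)
    ⟨k, Or.inl rfl⟩ ?_ hw
  rintro i - w ⟨j, hj⟩
  have hrefl : ∃ j', refl (simpleRootsC v i) (v j) = v j' ∨
      refl (simpleRootsC v i) (v j) = -v j' := by
    induction i using Fin.lastCases with
    | last => exact ⟨j, by rw [h.refl_last_apply]; split_ifs <;> simp⟩
    | cast i => exact ⟨_, Or.inl (h.refl_castSucc_apply i j)⟩
  obtain ⟨j', hj'⟩ := hrefl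
  refine ⟨j', ?_⟩
  rw [LinearIsometryEquiv.coe_mul, Function.comp_apply]
  rcases hj with hj | hj
  · rwa [hj]
  · rw [hj, map_neg, neg_eq_iff_eq_neg, neg_inj]
    exact hj'.symm

theorem apply_eq_self_of_apply_eq (h : IsOrthogonalFrame d v) {w : E ≃ₗᵢ[ℝ] E}
    {τ : Fin (n + 1) → Fin (n + 1)} (hτ : ∀ k, w (v k) = v (τ k))
    (hpos : ∀ k : Fin n, w (simpleRootsC v k.castSucc) ∈ posRootsC v) (k : Fin (n + 1)) :
    w (v k) = v k := by
  have hmono : StrictMono τ := Fin.strictMono_iff_lt_succ.2 fun k =>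
    h.lt_of_sub_mem_posRootsC (by
      have hk := hpos k
      rwa [simpleRootsC_castSucc, map_sub, hτ, hτ] at hk)
  rw [hτ, hmono.apply_eq]

theorem inner_map_heightVec_pos (h : IsOrthogonalFrame d v) {w : E ≃ₗᵢ[ℝ] E}
    (hpos : ∀ i, w (simpleRootsC v i) ∈ posRootsC v) (k : Fin (n + 1)) :
    0 < inner ℝ (w (v k)) (heightVec d v) := by
  have hanti : StrictAnti fun k => inner ℝ (w (v k)) (heightVec d v) :=
    Fin.strictAnti_iff_succ_lt.2 fun k => by
      have hk := h.inner_heightVec_pos_of_mem (hpos k.castSucc)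
      rwa [simpleRootsC_castSucc, map_sub, inner_sub_left, sub_pos] at hk
  have hlast := h.inner_heightVec_pos_of_mem (hpos (Fin.last n))
  rw [simpleRootsC_last, map_add, inner_add_left] at hlast
  exact (pos_add_self_iff.1 hlast).trans_le (hanti.antitone (Fin.le_last k))

theorem apply_eq_self_of_apply_eq_or_neg (h : IsOrthogonalFrame d v) {w : E ≃ₗᵢ[ℝ] E}
    (hw : ∀ k, ∃ i, w (v k) = v i ∨ w (v k) = -v i)
    (hpos : ∀ i, w (simpleRootsC v i) ∈ posRootsC v) (k : Fin (n + 1)) : w (v k) = v k := by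
  choose τ hτ using hw
  refine h.apply_eq_self_of_apply_eq (τ := τ) (fun k => (hτ k).resolve_right fun hneg => ?_)
    (fun k => hpos k.castSucc) k
  have hk := h.inner_map_heightVec_pos hpos k
  rw [hneg, inner_neg_left, neg_pos] at hk
  exact hk.not_gt (h.inner_heightVec_pos (τ k))

theorem isPositiveSystem_univ (h : IsOrthogonalFrame d v)
    (hspan : Submodule.span ℝ (Set.range v) = ⊤) :
    IsPositiveSystem (simpleRootsC v) Set.univ (posRootsC v) where
  finite := finite_posRootsC v
  neg_notMem _ := h.neg_notMem_posRootsC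
  simple_mem i _ := simpleRootsC_mem_posRootsC i
  refl_mem i _ β hβ hne := by
    induction i using Fin.lastCases with
    | last => exact h.refl_last_mem_posRootsC hβ hne
    | cast k => exact h.refl_castSucc_mem_posRootsC k hβ hne
  eq_one w hw hpos := linearIsometryEquiv_ext_of_span_eq_top hspan
    (h.apply_eq_self_of_apply_eq_or_neg (h.apply_eq_or_neg_of_mem_parabolic hw)
      fun i => hpos i trivial)

theorem isPositiveSystem_ne_last (h : IsOrthogonalFrame d v)
    (hspan : Submodule.span ℝ (Set.range v) = ⊤) :
    IsPositiveSystem (simpleRootsC v) {i | i ≠ Fin.last n} (posRootsA v) where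
  finite := finite_posRootsA v
  neg_notMem β hβ hneg := h.neg_notMem_posRootsC (Or.inl hβ) (Or.inl hneg)
  simple_mem := forall_ne_last.2 simpleRootsC_castSucc_mem_posRootsA
  refl_mem := forall_ne_last.2 fun k _ => h.refl_castSucc_mem_posRootsA k
  eq_one w hw hpos := by
    obtain ⟨τ, hτ⟩ := h.exists_apply_eq_of_mem_parabolic_ne_last hw
    exact linearIsometryEquiv_ext_of_span_eq_top hspan (h.apply_eq_self_of_apply_eq hτ
      fun k => Or.inl (forall_ne_last.1 hpos k))

theorem longest_univ_apply (h : IsOrthogonalFrame d v)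
    (hspan : Submodule.span ℝ (Set.range v) = ⊤) (k : Fin (n + 1)) :
    longest (simpleRootsC v) Set.univ (v k) = -v k := by
  have hP := h.isPositiveSystem_univ hspan
  rw [← neg_eq_iff_eq_neg]
  refine h.apply_eq_self_of_apply_eq_or_neg
    (w := LinearIsometryEquiv.neg ℝ * longest (simpleRootsC v) Set.univ) (fun k => ?_)
    (fun i => hP.neg_longest_simple_mem i trivial) k
  obtain ⟨i, hi⟩ := h.apply_eq_or_neg_of_mem_parabolic hP.longest_mem_parabolic k
  refine ⟨i, ?_⟩
  rw [LinearIsometryEquiv.coe_mul, Function.comp_apply, LinearIsometryEquiv.coe_neg,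
    neg_eq_iff_eq_neg, neg_inj]
  exact hi.symm

theorem longest_ne_last_apply (h : IsOrthogonalFrame d v)
    (hspan : Submodule.span ℝ (Set.range v) = ⊤) (k : Fin (n + 1)) :
    longest (simpleRootsC v) {i | i ≠ Fin.last n} (v k) = v k.rev := by
  have hP := h.isPositiveSystem_ne_last hspan
  obtain ⟨τ, hτ⟩ := h.exists_apply_eq_of_mem_parabolic_ne_last hP.longest_mem_parabolic
  have hmono : StrictMono fun k => (τ k).rev := Fin.strictMono_iff_lt_succ.2 fun k => by
    have hk := forall_ne_last.1 hP.neg_longest_simple_mem k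
    rw [simpleRootsC_castSucc, map_sub, neg_sub, hτ, hτ] at hk
    exact Fin.rev_lt_rev.2 (h.lt_of_sub_mem_posRootsC (Or.inl hk))
  rw [hτ, Fin.rev_eq_iff.1 (hmono.apply_eq (x := k))]

theorem omega_apply (h : IsOrthogonalFrame d v) (hspan : Submodule.span ℝ (Set.range v) = ⊤)
    (k : Fin (n + 1)) : omega (simpleRootsC v) (Fin.last n) (v k) = -v k.rev := by
  rw [omega, LinearIsometryEquiv.coe_mul, Function.comp_apply, h.longest_univ_apply hspan, map_neg,
    h.longest_ne_last_apply hspan]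

end IsOrthogonalFrame

end TypeC

section Types

variable {E : Type*} [NormedAddCommGroup E] [InnerProductSpace ℝ E]

theorem span_range_stdVec (l : ℕ) :
    Submodule.span ℝ (Set.range (stdVec (l := l))) = ⊤ := by
  have hbasis : stdVec (l := l) = (EuclideanSpace.basisFun (Fin l) ℝ).toBasis := by
    ext1 i
    rw [OrthonormalBasis.coe_toBasis, EuclideanSpace.basisFun_apply, stdVec]
  rw [hbasis, Module.Basis.span_eq]

theorem simpleC_eq_simpleRootsC (n : ℕ) : simpleC (n + 1) = simpleRootsC stdVec := by
  ext1 i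
  induction i using Fin.lastCases with
  | last => rw [simpleC, dif_neg (by simp), simpleRootsC_last, two_smul]
  | cast k =>
    rw [simpleC, dif_pos (by simp), simpleRootsC_castSucc]
    rfl

theorem map_simpleRootsC {A B : Type*} [AddCommGroup A] [AddCommGroup B] {n : ℕ} (f : A →+ B)
    (v : Fin (n + 1) → A) (i : Fin (n + 1)) :
    f (simpleRootsC v i) = simpleRootsC (fun k => f (v k)) i := by
  induction i using Fin.lastCases with
  | last => rw [simpleRootsC_last, simpleRootsC_last, map_add]
  | cast k => rw [simpleRootsC_castSucc, simpleRootsC_castSucc, map_sub]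

theorem IsTypeC.exists_isOrthogonalFrame {n : ℕ} {Φ : Set E} {α : Fin (n + 1) → E}
    (h : IsTypeC (n + 1) Φ α) :
    ∃ (d : ℝ) (v : Fin (n + 1) → E), IsOrthogonalFrame d v ∧
      Submodule.span ℝ (Set.range v) = ⊤ ∧ Φ = typeCRoots v ∧ α = simpleRootsC v := by
  obtain ⟨c, φ, hc, rfl, hα⟩ := h
  let f : EuclideanSpace ℝ (Fin (n + 1)) ≃ₗ[ℝ] E :=
    φ.toLinearEquiv.trans (LinearEquiv.smulOfNeZero ℝ E c hc.ne')
  refine ⟨_, fun k => f (stdVec k),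
    ((stdVec_isOrthogonalFrame (n + 1)).map φ.toLinearIsometry).smul hc, ?_, ?_, ?_⟩
  · rw [Set.range_comp' f stdVec, ← LinearEquiv.coe_coe, ← Submodule.map_span, span_range_stdVec,
      Submodule.map_top, LinearEquiv.range]
  · rw [rootsC_eq_typeCRoots]
    exact image_typeCRoots (f : EuclideanSpace ℝ (Fin (n + 1)) →+ E) stdVec
  · funext i
    rw [hα, simpleC_eq_simpleRootsC]
    exact map_simpleRootsC (f : EuclideanSpace ℝ (Fin (n + 1)) →+ E) stdVec i

theorem IsOrthogonalFrame.orthonormal {ι : Type*} {d : ℝ} {v : ι → E}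
    (h : IsOrthogonalFrame d v) : Orthonormal ℝ fun i => (√d)⁻¹ • v i := by
  have hd : 0 < √d := Real.sqrt_pos.2 h.pos
  constructor
  · intro i
    rw [norm_smul, h.norm_eq, norm_inv, Real.norm_of_nonneg hd.le, inv_mul_cancel₀ hd.ne']
  · intro i j hij
    simp only [inner_smul_left, inner_smul_right, h.inner_ne i j hij, mul_zero]

theorem IsOrthogonalFrame.exists_linearIsometry {m : ℕ} {d : ℝ} {v : Fin m → E}
    (h : IsOrthogonalFrame d v) :
    ∃ φ : EuclideanSpace ℝ (Fin m) →ₗᵢ[ℝ] E, ∀ i, √d • φ (stdVec i) = v i := by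
  let e := (EuclideanSpace.basisFun (Fin m) ℝ).toBasis
  let f : EuclideanSpace ℝ (Fin m) →ₗ[ℝ] E := e.constr ℝ fun i => (√d)⁻¹ • v i
  have hf : ∀ i, f (e i) = (√d)⁻¹ • v i := e.constr_basis ℝ _
  have he : Orthonormal ℝ e := by simp [e]
  have hfe : Orthonormal ℝ (f ∘ e) := by simpa only [Function.comp_def, hf] using h.orthonormal
  refine ⟨f.isometryOfOrthonormal he hfe, fun i => ?_⟩
  have hstd : stdVec i = e i := by simp [e, stdVec]
  change √d • f (stdVec i) = v i
  rw [hstd, hf, smul_inv_smul₀ (Real.sqrt_pos.2 h.pos).ne']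

theorem IsOrthogonalFrame.isTypeBC {m : ℕ} {d : ℝ} {v : Fin m → E}
    (h : IsOrthogonalFrame d v) : IsTypeBC m (typeBCRoots v) := by
  obtain ⟨φ, hφ⟩ := h.exists_linearIsometry
  let f : EuclideanSpace ℝ (Fin m) →+ E :=
    (DistribSMul.toAddMonoidHom E (√d)).comp φ.toLinearMap.toAddMonoidHom
  refine ⟨√d, φ, Real.sqrt_pos.2 h.pos, ?_⟩
  rw [rootsBC_eq_typeBCRoots]
  exact ((image_typeBCRoots f stdVec).trans (congrArg typeBCRoots (funext hφ))).symm

end Types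

section Counting

theorem card_injective_comp {ι X Y : Type*} [Fintype ι] [Finite X] [Finite Y] {π : X → Y} {k : ℕ}
    (hπ : ∀ y, Nat.card {x // π x = y} = k) :
    (Nat.card {f : ι → X // (π ∘ f).Injective} : ℤ) =
      ∏ i ∈ Finset.range (Fintype.card ι), ((Nat.card X : ℤ) - k * i) := by
  have := Fintype.ofFinite Y
  have hX : Nat.card X = Fintype.card Y * k := by
    rw [← Nat.card_congr (Equiv.sigmaFiberEquiv π), Nat.card_sigma]
    simp [hπ]
  let p : {f : ι → X // (π ∘ f).Injective} → (ι ↪ Y) := fun f => ⟨π ∘ f.1, f.2⟩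
  have hp : ∀ e, Nat.card {f // p f = e} = k ^ Fintype.card ι := fun e => by
    let fiberEquiv : {f // p f = e} ≃ ∀ i, {x // π x = e i} :=
      { toFun := fun f i => ⟨f.1.1 i, DFunLike.congr_fun f.2 i⟩
        invFun := fun g => ⟨⟨fun i => (g i).1, fun i j hij =>
          e.injective (by simpa only [Function.comp_apply, (g _).2] using hij)⟩,
          DFunLike.ext _ _ fun i => (g i).2⟩ }
    rw [Nat.card_congr fiberEquiv, Nat.card_pi, Finset.prod_congr rfl fun i _ => hπ (e i),
      Finset.prod_const, Finset.card_univ]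
  rw [← Nat.card_congr (Equiv.sigmaFiberEquiv p), Nat.card_sigma,
    Finset.sum_congr rfl fun e _ => hp e, Finset.sum_const, Finset.card_univ,
    Fintype.card_embedding_eq, smul_eq_mul, Nat.cast_mul, ← descPochhammer_eval_eq_descFactorial,
    descPochhammer_eval_eq_prod_range, Nat.cast_pow, hX,
    Finset.pow_eq_prod_const, ← Finset.prod_mul_distrib]
  refine Finset.prod_congr rfl fun i _ => ?_
  push_cast
  ring

theorem ncard_injOn_comp {ι X Y : Type*} [Fintype ι] [Finite X] {π : X → Y} {S : Set X} {k : ℕ}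
    (hπ : ∀ x ∈ S, {y ∈ S | π y = π x}.ncard = k) :
    ({f : ι → X | (∀ i, f i ∈ S) ∧ (π ∘ f).Injective}.ncard : ℤ) =
      ∏ i ∈ Finset.range (Fintype.card ι), ((S.ncard : ℤ) - k * i) := by
  let π' : S → Set.range (S.domRestrict π) := Set.rangeFactorization (S.domRestrict π)
  have hπ' : ∀ y, Nat.card {x // π' x = y} = k := by
    rintro ⟨_, x, rfl⟩
    rw [← hπ x x.2]
    refine Nat.card_congr ⟨fun y => ⟨y.1, y.1.2, congrArg Subtype.val y.2⟩,
      fun y => ⟨⟨y.1, y.2.1⟩, Subtype.ext y.2.2⟩, fun _ => rfl, fun _ => rfl⟩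
  rw [← Nat.card_coe_set_eq S, ← card_injective_comp hπ', ← Nat.card_coe_set_eq]
  congr 1
  refine Nat.card_congr ⟨fun f => ⟨fun i => ⟨f.1 i, f.2.1 i⟩, fun i j hij =>
      f.2.2 (congrArg Subtype.val hij)⟩,
    fun f => ⟨fun i => f.1 i, fun i => (f.1 i).2, fun i j hij => f.2 (Subtype.ext hij)⟩,
    fun _ => rfl, fun _ => rfl⟩

end Counting

section RegularTuples

variable {ι A : Type*} [AddCommGroup A]

/-- If `x = u + t / 2`, then no `x i - x j` (`i ≠ j`) and no `x i + x j` is zero. Only the doubled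
common shift `t` occurs, so that the notion makes sense where `2` is not invertible. -/
def IsRegular (t : A) (u : ι → A) : Prop :=
  u.Injective ∧ ∀ i j, u i + u j + t ≠ 0

variable (ι A) in
/-- The tuples `a` such that no `2 (a i - a j)` (`i ≠ j`) and no `2 (a i + a j)` is zero: the
integral coordinates of the points off the hyperplanes of the doubled root system of type `BC`. -/
def doubleRegularTuples : Set (ι → A) :=
  {a | IsRegular (0 : A) (2 • a)}

theorem isRegular_add_const {t s : A} {u : ι → A} :
    IsRegular t (fun i => u i + s) ↔ IsRegular (t + s + s) u := by
  have hadd : ∀ i j, u i + s + (u j + s) + t = u i + u j + (t + s + s) := fun i j => by abel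
  simp only [IsRegular, Function.Injective, add_left_inj, hadd]

theorem ncard_fiber_eq_card_ker {X : Type*} [AddCommGroup X] (δ : X →+ A) (x : X) :
    {y | δ y = δ x}.ncard = Nat.card δ.ker := by
  have himage : {y | δ y = δ x} = (x + ·) '' (δ.ker : Set X) := by
    ext y
    simp only [Set.image_add_left, Set.mem_preimage, SetLike.mem_coe, AddMonoidHom.mem_ker, map_add,
      map_neg, Set.mem_ofPred_eq]
    rw [neg_add_eq_zero, eq_comm]
  rw [himage, Set.ncard_image_of_injective _ (add_right_injective x), ← Nat.card_coe_set_eq]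
  rfl

theorem ncard_map_eq_or_map_eq {X : Type*} [AddCommGroup X] [Finite X] (δ : X →+ A) {x y : X}
    (hxy : δ x ≠ δ y) : {z | δ z = δ x ∨ δ z = δ y}.ncard = 2 * Nat.card δ.ker := by
  have hdisj : Disjoint {z | δ z = δ x} {z | δ z = δ y} :=
    Set.disjoint_left.2 fun _ hx hy => hxy (hx.symm.trans hy)
  rw [Set.ofPred_or, Set.ncard_union_eq hdisj, ncard_fiber_eq_card_ker, ncard_fiber_eq_card_ker,
    two_mul]

theorem ncard_isRegular_comp {X : Type*} [AddCommGroup X] [Finite X] [Fintype ι] (δ : X →+ A)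
    (t : X) :
    ({f : ι → X | IsRegular (δ t) (δ ∘ f)}.ncard : ℤ) =
      ∏ i ∈ Finset.range (Fintype.card ι),
        (({x | δ (x + x + t) ≠ 0}.ncard : ℤ) - 2 * Nat.card δ.ker * i) := by
  let π : X → Sym2 A := fun x => s(δ x, δ (-(x + t)))
  have hπ : ∀ x y, π y = π x ↔ δ y = δ x ∨ δ y = δ (-(x + t)) := fun x y => by
    simp only [π, Sym2.eq_iff, map_neg, map_add, neg_add_rev]
    constructor
    · exact Or.imp And.left And.left
    · refine Or.imp (fun h => ⟨h, by rw [h]⟩) fun h => ⟨h, by rw [h]; abel⟩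
  have hclass : ∀ x ∈ {x | δ (x + x + t) ≠ 0},
      {y ∈ {x | δ (x + x + t) ≠ 0} | π y = π x}.ncard = 2 * Nat.card δ.ker := fun x hx => by
    have hne : δ x ≠ δ (-(x + t)) := fun h => hx (by
      rwa [map_neg, eq_neg_iff_add_eq_zero, ← map_add, ← add_assoc] at h)
    rw [← ncard_map_eq_or_map_eq δ hne]
    congr 1
    ext y
    simp only [hπ, Set.mem_ofPred_eq, and_iff_right_iff_imp]
    rintro (h | h)
    · rwa [map_add, map_add, h, ← map_add, ← map_add]
    · rw [map_add, map_add, h, ← map_add, ← map_add,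
        show -(x + t) + -(x + t) + t = -(x + x + t) by abel, map_neg]
      exact neg_ne_zero.2 hx
  have hset : {f : ι → X | IsRegular (δ t) (δ ∘ f)} =
      {f | (∀ i, f i ∈ {x | δ (x + x + t) ≠ 0}) ∧ (π ∘ f).Injective} := by
    ext f
    have hneg : ∀ i j, δ (f i) = δ (-(f j + t)) ↔ δ (f i) + δ (f j) + δ t = 0 := fun i j => by
      rw [map_neg, eq_neg_iff_add_eq_zero, map_add, add_assoc]
    simp only [IsRegular, Function.Injective, Function.comp_apply, Set.mem_ofPred_eq, hπ, hneg,
      map_add]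
    constructor
    · rintro ⟨hinj, hsum⟩
      exact ⟨fun i => hsum i i, fun i j h => hinj (h.resolve_right (hsum i j))⟩
    · rintro ⟨hsum, hinj⟩
      refine ⟨fun i j h => hinj (Or.inl h), fun i j h => ?_⟩
      obtain rfl := hinj (Or.inr h)
      exact hsum i h
  rw [hset, ncard_injOn_comp hclass, Nat.cast_mul, Nat.cast_two]

theorem ncard_map_ne {X : Type*} [AddCommGroup X] [Finite X] (δ : X →+ A) (x : X) :
    ({y | δ y ≠ δ x}.ncard : ℤ) = Nat.card X - Nat.card δ.ker := by
  rw [← ncard_fiber_eq_card_ker δ x, eq_sub_iff_add_eq']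
  exact_mod_cast Set.ncard_add_ncard_compl {y | δ y = δ x}

variable (A) in
/-- The homomorphism `a ↦ 2 a`; its kernel is the 2-torsion of `A`. -/
abbrev doubling : A →+ A :=
  nsmulAddMonoidHom 2

theorem ncard_isRegular [Finite A] [Fintype ι] (t : A) :
    ({u : ι → A | IsRegular t u}.ncard : ℤ) =
      ∏ i ∈ Finset.range (Fintype.card ι), (({x : A | x + x + t ≠ 0}.ncard : ℤ) - 2 * i) := by
  have h := ncard_isRegular_comp (ι := ι) (AddMonoidHom.id A) t
  simpa only [AddMonoidHom.id_apply, AddMonoidHom.coe_id, Function.id_comp, AddMonoidHom.ker_id,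
    AddSubgroup.card_bot, Nat.cast_one, mul_one] using h

theorem ncard_add_self_add_ne_zero_of_mem_range [Finite A] {t : A} (ht : t ∈ (doubling A).range) :
    ({x : A | x + x + t ≠ 0}.ncard : ℤ) = Nat.card A - Nat.card (doubling A).ker := by
  obtain ⟨s, rfl⟩ := ht
  rw [← ncard_map_ne (doubling A) (-s), map_neg]
  simp only [nsmulAddMonoidHom_apply, two_nsmul, ne_eq, ← eq_neg_iff_add_eq_zero]

theorem ncard_add_self_add_ne_zero_of_notMem_range {t : A} (ht : t ∉ (doubling A).range) :
    {x : A | x + x + t ≠ 0}.ncard = Nat.card A := by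
  have hne : ∀ x : A, x + x + t ≠ 0 := fun x hx => ht
    ⟨-x, by rw [map_neg, nsmulAddMonoidHom_apply, two_nsmul, neg_eq_iff_add_eq_zero, hx]⟩
  simp only [ne_eq, hne, not_false_eq_true, Set.ofPred_true, Set.ncard_univ]

theorem card_ker_nsmul_zmod (q d : ℕ) [NeZero q] :
    Nat.card (nsmulAddMonoidHom (α := ZMod q) d).ker = q.gcd d := by
  rw [IsAddCyclic.card_nsmulAddMonoidHom_ker, Nat.card_zmod]

theorem ncard_doubleRegularTuples_zmod [Fintype ι] {q : ℕ} [NeZero q] (hq : Even q) :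
    ((doubleRegularTuples ι (ZMod q)).ncard : ℤ) =
      ∏ i ∈ Finset.range (Fintype.card ι), ((q : ℤ) - Nat.gcd 4 q - 4 * i) := by
  have h := ncard_isRegular_comp (ι := ι) (doubling (ZMod q)) 0
  have hfour : {x : ZMod q | doubling (ZMod q) (x + x + 0) ≠ 0} =
      {x | nsmulAddMonoidHom 4 x ≠ nsmulAddMonoidHom (α := ZMod q) 4 0} := by
    ext x
    simp only [nsmulAddMonoidHom_apply, smul_zero, add_zero, ← two_nsmul, ← mul_nsmul,
      Nat.reduceMul]
  rw [hfour, ncard_map_ne, map_zero, card_ker_nsmul_zmod, card_ker_nsmul_zmod, Nat.card_zmod,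
    Nat.gcd_eq_right hq.two_dvd, Nat.gcd_comm q 4] at h
  simp only [Nat.cast_ofNat, show (2 * 2 : ℤ) = 4 by norm_num] at h
  exact h

end RegularTuples

section QuasiPolynomials

variable {ι A : Type*} [DecidableEq ι] [AddCommGroup A]

variable (A) in
/-- The tuples `z` with `z r = 2 x r` and `z k = x k - x r` for `k ≠ r` such that no `x i - x j`
(`i ≠ j`) and no `x i + x j` is zero. These coordinates are used because all of them are integral on
the coweight lattice of type `C`, where the `x i` themselves may be half-integers. -/
def regularTuples (r : ι) : Set (ι → A) :=
  {z | IsRegular (z r) (Function.update z r 0)}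

/-- Translating `u` by `s` and the shift by `-2 s` leaves `IsRegular` invariant; the translations
are parametrized by the value `s = u r`. -/
def translateEquiv (r : ι) : A × (ι → A) ≃ A × (ι → A) where
  toFun p := (p.2 r - p.1 - p.1, fun k => Function.update p.2 r 0 k + p.1)
  invFun p := (p.2 r, Function.update (fun k => p.2 k - p.2 r) r (p.1 + p.2 r + p.2 r))
  left_inv p := by
    ext k
    · simp
    · by_cases hk : k = r
      · subst hk; simp
      · simp [hk]
  right_inv p := by
    ext k
    · simp
    · by_cases hk : k = r
      · subst hk; simp
      · simp [hk]

theorem card_mul_ncard_regularTuples [Finite ι] [Fintype A] (r : ι) :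
    Nat.card A * (regularTuples A r).ncard = ∑ t : A, {u : ι → A | IsRegular t u}.ncard := by
  have he : ∀ p : A × (ι → A), p.2 ∈ regularTuples A r ↔
      IsRegular (translateEquiv r p).1 (translateEquiv r p).2 := fun p => by
    simp only [translateEquiv, Equiv.coe_fn_mk, isRegular_add_const, sub_add_cancel, regularTuples,
      Set.mem_ofPred_eq]
  calc Nat.card A * (regularTuples A r).ncard
      = Nat.card {p : A × (ι → A) // p.2 ∈ regularTuples A r} := by
        rw [← Nat.card_coe_set_eq, ← Nat.card_prod]
        exact Nat.card_congr ⟨fun p => ⟨(p.1, p.2.1), p.2.2⟩, fun p => (p.1.1, ⟨p.1.2, p.2⟩),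
          fun _ => rfl, fun _ => rfl⟩
    _ = Nat.card (Σ t : A, {u : ι → A // IsRegular t u}) := Nat.card_congr <|
        ((translateEquiv r).subtypeEquiv he).trans
          (Equiv.subtypeProdEquivSigmaSubtype fun t u => IsRegular t u)
    _ = ∑ t : A, {u : ι → A | IsRegular t u}.ncard := by
        rw [Nat.card_sigma]
        rfl

theorem card_ker_mul_ncard_regularTuples [Finite A] [Fintype ι] (r : ι) :
    (Nat.card (doubling A).ker : ℤ) * (regularTuples A r).ncard =
      ∏ i ∈ Finset.range (Fintype.card ι),
        ((Nat.card A : ℤ) - Nat.card (doubling A).ker - 2 * i) +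
      (Nat.card (doubling A).ker - 1) *
        ∏ i ∈ Finset.range (Fintype.card ι), ((Nat.card A : ℤ) - 2 * i) := by
  classical
  have := Fintype.ofFinite A
  set P := ∏ i ∈ Finset.range (Fintype.card ι),
    ((Nat.card A : ℤ) - Nat.card (doubling A).ker - 2 * i)
  set Q := ∏ i ∈ Finset.range (Fintype.card ι), ((Nat.card A : ℤ) - 2 * i)
  have hterm : ∀ t : A, ({u : ι → A | IsRegular t u}.ncard : ℤ) =
      Q + if t ∈ (doubling A).range then P - Q else 0 := fun t => by
    rw [ncard_isRegular]
    split_ifs with ht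
    · rw [ncard_add_self_add_ne_zero_of_mem_range ht, add_sub_cancel]
    · rw [ncard_add_self_add_ne_zero_of_notMem_range ht, add_zero]
  have hsum : (Nat.card A : ℤ) * (regularTuples A r).ncard =
      Nat.card A * Q + Nat.card (doubling A).range * (P - Q) := by
    rw [← Nat.cast_mul, card_mul_ncard_regularTuples, Nat.cast_sum,
      Finset.sum_congr rfl fun t _ => hterm t, Finset.sum_add_distrib, ← Finset.sum_filter]
    simp only [Finset.sum_const, nsmul_eq_mul, Finset.card_univ, ← Nat.card_eq_fintype_card]
    rw [← Fintype.card_subtype, ← Nat.card_eq_fintype_card]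
  have hcard : (Nat.card (doubling A).ker : ℤ) * Nat.card (doubling A).range = Nat.card A := by
    rw [← AddSubgroup.index_ker, ← Nat.cast_mul, AddSubgroup.card_mul_index]
  have hA : (Nat.card A : ℤ) ≠ 0 := Nat.cast_ne_zero.2 Nat.card_pos.ne'
  refine mul_left_cancel₀ hA ?_
  linear_combination (Nat.card (doubling A).ker : ℤ) * hsum + (P - Q) * hcard

theorem prod_Icc_one_eq_prod_range {M : Type*} [CommMonoid M] (f : ℕ → M) (n : ℕ) :
    ∏ i ∈ Finset.Icc 1 n, f i = ∏ i ∈ Finset.range n, f (i + 1) := by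
  rw [Finset.range_eq_Ico, Finset.prod_Ico_add' f 0 n 1, zero_add]
  rfl

theorem ncard_regularTuples_zmod_of_odd [Fintype ι] (r : ι) {q : ℕ} [NeZero q] (hq : Odd q) :
    ((regularTuples (ZMod q) r).ncard : ℤ) =
      ∏ i ∈ Finset.Icc 1 (Fintype.card ι), ((q : ℤ) - (2 * (i : ℤ) - 1)) := by
  have h := card_ker_mul_ncard_regularTuples (A := ZMod q) r
  rw [card_ker_nsmul_zmod, Nat.card_zmod, Nat.coprime_two_right.2 hq] at h
  rw [prod_Icc_one_eq_prod_range, ← one_mul ((regularTuples (ZMod q) r).ncard : ℤ), ← Nat.cast_one,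
    h, Nat.cast_one, sub_self, zero_mul, add_zero]
  refine Finset.prod_congr rfl fun i _ => ?_
  push_cast
  ring

theorem ncard_regularTuples_zmod_of_even [Fintype ι] (r : ι) {q : ℕ} [NeZero q] (hq : Even q) :
    ((regularTuples (ZMod q) r).ncard : ℤ) =
      (∏ i ∈ Finset.Icc 1 (Fintype.card ι - 1), ((q : ℤ) - 2 * (i : ℤ))) *
        ((q : ℤ) - Fintype.card ι) := by
  obtain ⟨n, hn⟩ := Nat.exists_eq_add_one.2 (Fintype.card_pos_iff.2 ⟨r⟩)
  have h := card_ker_mul_ncard_regularTuples (A := ZMod q) r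
  rw [card_ker_nsmul_zmod, Nat.card_zmod, Nat.gcd_eq_right hq.two_dvd, hn, Finset.prod_range_succ,
    Finset.prod_range_succ'] at h
  have hshift : ∀ i : ℕ, (q : ℤ) - (2 : ℕ) - 2 * i = q - 2 * ((i + 1 : ℕ) : ℤ) := fun i => by
    push_cast
    ring
  simp only [hshift] at h
  rw [hn, Nat.add_sub_cancel, prod_Icc_one_eq_prod_range]
  push_cast at h ⊢
  linarith

end QuasiPolynomials

section OddExtension

variable {A : Type*} [AddCommGroup A] {m : ℕ}

/-- The middle index of `Fin (2 * m + 1)`. -/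
def midIndex (m : ℕ) : Fin (2 * m + 1) :=
  ⟨m, by omega⟩

/-- The `i`-th index of `Fin (2 * m + 1)` below the middle; its mirror image is
`(lowIndex i).rev`. -/
def lowIndex (i : Fin m) : Fin (2 * m + 1) :=
  ⟨i, by omega⟩

theorem rev_midIndex : (midIndex m).rev = midIndex m := by
  ext
  simp only [midIndex, Fin.val_rev]
  omega

theorem lowIndex_ne_midIndex (i : Fin m) : lowIndex i ≠ midIndex m := fun h =>
  i.2.ne (Fin.mk.inj h)

theorem rev_lowIndex_ne_midIndex (i : Fin m) : (lowIndex i).rev ≠ midIndex m := fun h =>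
  lowIndex_ne_midIndex i (by rw [← Fin.rev_rev (lowIndex i), h, rev_midIndex])

theorem index_cases (k : Fin (2 * m + 1)) :
    k = midIndex m ∨ ∃ i : Fin m, k = lowIndex i ∨ k = (lowIndex i).rev := by
  simp only [midIndex, lowIndex, Fin.ext_iff, Fin.val_rev]
  rcases lt_trichotomy (k : ℕ) m with h | h | h
  · exact Or.inr ⟨⟨k, h⟩, Or.inl rfl⟩
  · exact Or.inl h
  · exact Or.inr ⟨⟨2 * m - k, by omega⟩, Or.inr (by simp only; omega)⟩

/-- The extension of `h` to a function that is odd under the reversal of `Fin (2 * m + 1)`. -/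
def oddExtension (h : Fin m → A) (k : Fin (2 * m + 1)) : A :=
  if hk : (k : ℕ) < m then h ⟨k, hk⟩
  else if hk' : (k.rev : ℕ) < m then -h ⟨k.rev, hk'⟩ else 0

theorem oddExtension_lowIndex (h : Fin m → A) (i : Fin m) : oddExtension h (lowIndex i) = h i :=
  dif_pos i.2

theorem oddExtension_rev_lowIndex (h : Fin m → A) (i : Fin m) :
    oddExtension h (lowIndex i).rev = -h i := by
  have hi : ¬((lowIndex i).rev : ℕ) < m := by simp only [lowIndex, Fin.val_rev]; omega
  rw [oddExtension, dif_neg hi]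
  simp only [Fin.rev_rev, lowIndex, i.2, dite_true]

theorem oddExtension_midIndex (h : Fin m → A) : oddExtension h (midIndex m) = 0 := by
  have hm : ¬(midIndex m : ℕ) < m := lt_irrefl m
  rw [oddExtension, dif_neg hm, dif_neg (by rwa [rev_midIndex])]

theorem oddExtension_rev (h : Fin m → A) (k : Fin (2 * m + 1)) :
    oddExtension h k.rev = -oddExtension h k := by
  rcases index_cases k with rfl | ⟨i, rfl | rfl⟩
  · rw [rev_midIndex, oddExtension_midIndex, neg_zero]
  · rw [oddExtension_rev_lowIndex, oddExtension_lowIndex]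
  · rw [Fin.rev_rev, oddExtension_rev_lowIndex, oddExtension_lowIndex, neg_neg]

theorem eq_oddExtension {u : Fin (2 * m + 1) → A} (hmid : u (midIndex m) = 0)
    (hrev : ∀ i, u (lowIndex i).rev = -u (lowIndex i)) : u = oddExtension (u ∘ lowIndex) := by
  funext k
  rcases index_cases k with rfl | ⟨i, rfl | rfl⟩
  · rw [hmid, oddExtension_midIndex]
  · rw [oddExtension_lowIndex, Function.comp_apply]
  · rw [oddExtension_rev_lowIndex, hrev, Function.comp_apply]

theorem map_oddExtension {B : Type*} [AddCommGroup B] (f : A →+ B) (h : Fin m → A) :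
    f ∘ oddExtension h = oddExtension (f ∘ h) := by
  have hlow : (f ∘ oddExtension h) ∘ lowIndex = f ∘ h :=
    funext fun i => congrArg f (oddExtension_lowIndex h i)
  rw [eq_oddExtension (u := f ∘ oddExtension h), hlow]
  · rw [Function.comp_apply, oddExtension_midIndex, map_zero]
  · exact fun i => by rw [Function.comp_apply, oddExtension_rev, map_neg, Function.comp_apply]

theorem injective_oddExtension_iff {h : Fin m → A} :
    (oddExtension h).Injective ↔ IsRegular 0 h := by
  constructor
  · intro hinj
    refine ⟨fun i j hij => ?_, fun i j hij => ?_⟩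
    · have := @hinj (lowIndex i) (lowIndex j) (by
        rwa [oddExtension_lowIndex, oddExtension_lowIndex])
      exact Fin.ext (Fin.mk.inj this)
    · have := @hinj (lowIndex i) (lowIndex j).rev (by
        rw [oddExtension_lowIndex, oddExtension_rev_lowIndex, eq_neg_iff_add_eq_zero, ← hij,
          add_zero])
      simp only [lowIndex, Fin.ext_iff, Fin.val_rev] at this
      omega
  · rintro ⟨hinj, hsum⟩ k k' hk
    have hneg : ∀ i j, h i ≠ -h j := fun i j hij => hsum i j (by rw [hij]; abel)
    have hzero : ∀ i, h i ≠ 0 := fun i hi => hneg i i (by rw [hi, neg_zero])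
    rcases index_cases k with rfl | ⟨i, rfl | rfl⟩ <;>
      rcases index_cases k' with rfl | ⟨j, rfl | rfl⟩ <;>
      simp only [oddExtension_lowIndex, oddExtension_rev_lowIndex, oddExtension_midIndex] at hk
    · rfl
    · exact absurd hk.symm (hzero j)
    · exact absurd (neg_eq_zero.1 hk.symm) (hzero j)
    · exact absurd hk (hzero i)
    · rw [hinj hk]
    · exact absurd hk (hneg i j)
    · exact absurd (neg_eq_zero.1 hk) (hzero i)
    · exact absurd hk.symm (hneg j i)
    · rw [hinj (neg_injective hk)]

theorem typeCRoots_oddExtension_subset (h : Fin m → A) :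
    typeCRoots (oddExtension h) ⊆ insert 0 (typeBCRoots h) := by
  have hsub : ∀ i j, h i - h j ∈ insert 0 (typeBCRoots h) := fun i j => by
    by_cases hij : i = j
    · exact Or.inl (by rw [hij, sub_self])
    · exact Or.inr (Or.inl (sub_mem_typeCRoots hij))
  have hadd : ∀ i j, oddExtension h i + oddExtension h j ∈ insert 0 (typeBCRoots h) := fun i j => by
    rcases index_cases i with rfl | ⟨i, rfl | rfl⟩ <;>
      rcases index_cases j with rfl | ⟨j, rfl | rfl⟩ <;>
      simp only [oddExtension_lowIndex, oddExtension_rev_lowIndex, oddExtension_midIndex,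
        zero_add, add_zero, ← sub_eq_add_neg, zero_sub, neg_add_eq_sub, ← neg_add']
    · exact Or.inl rfl
    · exact Or.inr (mem_typeBCRoots j)
    · exact Or.inr (Or.inr ⟨j, Or.inr rfl⟩)
    · exact Or.inr (mem_typeBCRoots i)
    · exact Or.inr (Or.inl (add_mem_typeCRoots i j))
    · exact hsub i j
    · exact Or.inr (Or.inr ⟨i, Or.inr rfl⟩)
    · exact hsub j i
    · exact Or.inr (Or.inl (neg_mem_typeCRoots (add_mem_typeCRoots i j)))
  rintro β (⟨i, j, -, rfl⟩ | ⟨i, j, rfl | rfl⟩)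
  · rw [sub_eq_add_neg, ← oddExtension_rev]
    exact hadd i j.rev
  · exact hadd i j
  · rw [neg_add, ← oddExtension_rev, ← oddExtension_rev]
    exact hadd i.rev j.rev

theorem typeCRoots_oddExtension_diff_zero {h : Fin m → A} (hh : IsRegular 0 h) :
    typeCRoots (oddExtension h) \ {0} = typeBCRoots h := by
  have hsum : ∀ i j, h i + h j ≠ 0 := fun i j => by simpa only [add_zero] using hh.2 i j
  refine Set.Subset.antisymm
    (Set.sdiff_singleton_subset_iff.2 (typeCRoots_oddExtension_subset h)) ?_
  refine (forall_typeBCRoots fun β hβ => ⟨neg_mem_typeCRoots hβ.1, neg_ne_zero.2 hβ.2⟩).2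
    ⟨(forall_typeCRoots fun β hβ => ⟨neg_mem_typeCRoots hβ.1, neg_ne_zero.2 hβ.2⟩).2 ⟨?_, ?_⟩, ?_⟩
  · intro i j hij
    have hne : lowIndex i ≠ lowIndex j := fun h => hij (Fin.ext (Fin.mk.inj h))
    have hmem := sub_mem_typeCRoots (v := oddExtension h) hne
    rw [oddExtension_lowIndex, oddExtension_lowIndex] at hmem
    exact ⟨hmem, sub_ne_zero.2 (hh.1.ne hij)⟩
  · intro i j
    have hmem := add_mem_typeCRoots (v := oddExtension h) (lowIndex i) (lowIndex j)
    rw [oddExtension_lowIndex, oddExtension_lowIndex] at hmem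
    exact ⟨hmem, hsum i j⟩
  · intro i
    have hmem := add_mem_typeCRoots (v := oddExtension h) (lowIndex i) (midIndex m)
    rw [oddExtension_lowIndex, oddExtension_midIndex, add_zero] at hmem
    exact ⟨hmem, fun hi : h i = 0 => hsum i i (by rw [hi, add_zero])⟩

/-- The tuples in `regularTuples` that are fixed by the involution `x k ↦ -x k.rev`. -/
def fixedTuples (m : ℕ) (A : Type*) [AddCommGroup A] : Set (Fin (2 * m + 1) → A) :=
  {z ∈ regularTuples A (midIndex m) | ∀ k, z k + z k.rev = 0}

theorem fixedTuples_eq_empty (hA : ∀ a : A, a + a = 0 → a = 0) : fixedTuples m A = ∅ := by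
  refine Set.eq_empty_of_forall_notMem fun z hz => hz.1.2 (midIndex m) (midIndex m) ?_
  have hmid := hz.2 (midIndex m)
  rw [rev_midIndex] at hmid
  rw [Function.update_self, hA _ hmid, add_zero, add_zero]

variable {ε : A}

theorem isRegular_oddExtension_iff (hε : ∀ a : A, a + a = 0 ↔ a = 0 ∨ a = ε) (hε0 : ε ≠ 0)
    {a : Fin m → A} : IsRegular ε (oddExtension a) ↔ a ∈ doubleRegularTuples (Fin m) A := by
  have hεneg : -ε = ε := neg_eq_of_add_eq_zero_right ((hε ε).2 (Or.inr rfl))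
  have hdouble : ∀ x y : A, 2 • x = 2 • y ↔ x = y ∨ x + -y + ε = 0 := fun x y => by
    rw [← sub_eq_zero (a := 2 • x), ← smul_sub, two_nsmul, hε, sub_eq_zero, ← sub_eq_add_neg,
      add_eq_zero_iff_eq_neg, hεneg]
  have hinj : a ∈ doubleRegularTuples (Fin m) A ↔ (2 • oddExtension a).Injective := by
    rw [show 2 • oddExtension a = oddExtension (2 • a) from map_oddExtension (doubling A) a]
    exact injective_oddExtension_iff.symm
  rw [hinj]
  simp only [IsRegular, Function.Injective, Pi.smul_apply, hdouble]
  constructor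
  · rintro ⟨hinj, hsum⟩ k k' (h | h)
    · exact hinj h
    · exact absurd h (by rw [← oddExtension_rev]; exact hsum k k'.rev)
  · refine fun h => ⟨fun k k' hk => h (Or.inl hk), fun k k' hk => hε0 ?_⟩
    rw [← Fin.rev_rev k', oddExtension_rev] at hk
    obtain rfl := h (Or.inr hk)
    rwa [add_neg_cancel, zero_add] at hk

theorem fixedTuples_eq_image (hε : ∀ a : A, a + a = 0 ↔ a = 0 ∨ a = ε) (hε0 : ε ≠ 0) :
    fixedTuples m A =
      (fun a => Function.update (oddExtension a) (midIndex m) ε) ''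
        doubleRegularTuples (Fin m) A := by
  ext z
  simp only [fixedTuples, regularTuples, Set.mem_ofPred_eq, Set.mem_image,
    ← isRegular_oddExtension_iff hε hε0]
  constructor
  · rintro ⟨hz, hrev⟩
    have hmid : z (midIndex m) = ε := by
      have h := (hε _).1 ((congrArg (z _ + z ·) rev_midIndex.symm).trans (hrev (midIndex m)))
      refine h.resolve_left fun h0 => hz.2 (midIndex m) (midIndex m) ?_
      rw [Function.update_self, h0, add_zero, add_zero]
    have hodd := eq_oddExtension (u := Function.update z (midIndex m) 0)
      (Function.update_self ..) fun i => by
        rw [Function.update_of_ne (lowIndex_ne_midIndex i),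
          Function.update_of_ne (rev_lowIndex_ne_midIndex i)]
        exact eq_neg_of_add_eq_zero_right (hrev _)
    refine ⟨_, hodd ▸ hmid ▸ hz, ?_⟩
    simp only [← hodd, Function.update_idem, ← hmid, Function.update_eq_self]
  · rintro ⟨a, ha, rfl⟩
    rw [Function.update_self, Function.update_idem,
      Function.update_eq_self_iff.2 (oddExtension_midIndex a).symm]
    refine ⟨ha, fun k => ?_⟩
    by_cases hk : k = midIndex m
    · subst hk
      rw [rev_midIndex, Function.update_self]
      exact (hε ε).2 (Or.inr rfl)
    · have hk' : k.rev ≠ midIndex m := fun h => hk (by rw [← Fin.rev_rev k, h, rev_midIndex])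
      rw [Function.update_of_ne hk, Function.update_of_ne hk', oddExtension_rev, add_neg_cancel]

theorem exists_add_self_eq_zero_iff_of_card_ker_doubling (hA : Nat.card (doubling A).ker = 2) :
    ∃ ε : A, ε ≠ 0 ∧ ∀ a, a + a = 0 ↔ a = 0 ∨ a = ε := by
  obtain ⟨⟨ε, hε⟩, hε0, huniq⟩ := (Nat.card_eq_two_iff' (0 : (doubling A).ker)).1 hA
  simp only [AddMonoidHom.mem_ker, nsmulAddMonoidHom_apply, two_nsmul, Subtype.forall, ne_eq,
    AddSubgroup.mk_eq_zero, Subtype.mk.injEq] at hε hε0 huniq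
  refine ⟨ε, hε0, fun a => ⟨fun ha => or_iff_not_imp_left.2 (huniq a ha), ?_⟩⟩
  rintro (rfl | rfl)
  · exact add_zero 0
  · exact hε

theorem ncard_fixedTuples (hA : Nat.card (doubling A).ker = 2) :
    (fixedTuples m A).ncard = (doubleRegularTuples (Fin m) A).ncard := by
  obtain ⟨ε, hε0, hε⟩ := exists_add_self_eq_zero_iff_of_card_ker_doubling hA
  rw [fixedTuples_eq_image hε hε0, Set.ncard_image_of_injective]
  intro a b hab
  funext i
  have h := congrFun hab (lowIndex i)
  simpa only [Function.update_of_ne (lowIndex_ne_midIndex i), oddExtension_lowIndex] using h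

theorem ncard_fixedTuples_zmod_of_odd {q : ℕ} (hq : Odd q) :
    (fixedTuples m (ZMod q)).ncard = 0 := by
  rw [fixedTuples_eq_empty fun a => (ZMod.add_self_eq_zero_iff_eq_zero hq).1, Set.ncard_empty]

theorem ncard_fixedTuples_zmod_of_even {q : ℕ} [NeZero q] (hq : Even q) :
    (fixedTuples m (ZMod q)).ncard = (doubleRegularTuples (Fin m) (ZMod q)).ncard :=
  ncard_fixedTuples (by rw [card_ker_nsmul_zmod, Nat.gcd_eq_right hq.two_dvd])

end OddExtension

section Lattice

variable {E : Type*} [NormedAddCommGroup E] [InnerProductSpace ℝ E]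

theorem projQ_eq_iff {L : AddSubgroup E} {q : ℕ} {x y : L} :
    projQ L q x = projQ L q y ↔ ∃ z : L, (y : E) = x + (q : ℝ) • (z : E) := by
  rw [projQ, projQ, QuotientAddGroup.eq]
  constructor
  · rintro ⟨z, hz⟩
    refine ⟨z, ?_⟩
    have h := congrArg (Subtype.val) hz
    simp only [nsmulAddMonoidHom_apply, AddSubgroup.coe_nsmul, AddSubgroup.coe_add,
      AddSubgroup.coe_neg] at h
    rw [Nat.cast_smul_eq_nsmul, h]
    abel
  · rintro ⟨z, hz⟩
    refine ⟨z, Subtype.ext ?_⟩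
    simp only [nsmulAddMonoidHom_apply, AddSubgroup.coe_nsmul, AddSubgroup.coe_add,
      AddSubgroup.coe_neg]
    rw [hz, Nat.cast_smul_eq_nsmul]
    abel

/-- The vectors `g k` are integral coordinates on the lattice `L`. -/
structure IsCoordinates {κ : Type*} (L : AddSubgroup E) (g : κ → E) : Prop where
  integral : ∀ x ∈ L, ∀ k, ∃ n : ℤ, inner ℝ (g k) x = n
  eq_zero : ∀ x ∈ L, (∀ k, inner ℝ (g k) x = 0) → x = 0
  exists_mem : ∀ n : κ → ℤ, ∃ x ∈ L, ∀ k, inner ℝ (g k) x = n k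

namespace IsCoordinates

variable {κ : Type*} {L : AddSubgroup E} {g : κ → E}

theorem projQ_eq_iff (h : IsCoordinates L g) {q : ℕ} {x y : L} {m n : κ → ℤ}
    (hm : ∀ k, inner ℝ (g k) (x : E) = m k) (hn : ∀ k, inner ℝ (g k) (y : E) = n k) :
    projQ L q x = projQ L q y ↔ ∀ k, (m k : ZMod q) = n k := by
  rw [RootChar.projQ_eq_iff]
  constructor
  · rintro ⟨z, hz⟩ k
    obtain ⟨t, ht⟩ := h.integral z z.2 k
    have h1 : n k = m k + q * t := by
      have h2 := hn k
      rw [hz, inner_add_right, inner_smul_right, hm, ht] at h2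
      exact_mod_cast h2.symm
    rw [h1]
    simp
  · intro hk
    have : ∀ k, ∃ t : ℤ, n k = m k + q * t := fun k => by
      obtain ⟨t, ht⟩ := (ZMod.intCast_eq_intCast_iff_dvd_sub _ _ _).1 (hk k)
      exact ⟨t, by linarith⟩
    choose t ht using this
    obtain ⟨z, hz, hzt⟩ := h.exists_mem t
    refine ⟨⟨z, hz⟩, ?_⟩
    have h0 : (y : E) - (x + q • z) = 0 := by
      refine h.eq_zero _ (sub_mem y.2 (add_mem x.2 (nsmul_mem hz q))) fun k => ?_
      rw [← Nat.cast_smul_eq_nsmul ℝ, inner_sub_right, inner_add_right, inner_smul_right, hm, hn,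
        hzt, ht]
      push_cast
      ring
    rw [← Nat.cast_smul_eq_nsmul ℝ] at h0
    exact sub_eq_zero.1 h0

theorem ncard_eq (h : IsCoordinates L g) {q : ℕ} (s : Set (ModQ L q)) (s' : Set (κ → ZMod q))
    (hs : ∀ (x : L) (n : κ → ℤ), (∀ k, inner ℝ (g k) (x : E) = n k) →
      (projQ L q x ∈ s ↔ (fun k => (n k : ZMod q)) ∈ s')) :
    s.ncard = s'.ncard := by
  have hsurj : ∀ p : ModQ L q, ∃ x, projQ L q x = p := fun p => QuotientAddGroup.mk_surjective p
  choose rep hrep using hsurj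
  choose n hn using fun x : L => h.integral x x.2
  refine Set.ncard_congr (fun p _ k => (n (rep p) k : ZMod q)) ?_ ?_ ?_
  · intro p hp
    exact (hs _ _ (hn _)).1 ((hrep p).symm ▸ hp)
  · intro p p' _ _ hpp
    rw [← hrep p, ← hrep p', h.projQ_eq_iff (hn _) (hn _)]
    exact congrFun hpp
  · intro z hz
    choose m hm using fun k => ZMod.intCast_surjective (z k)
    obtain ⟨x, hx, hxm⟩ := h.exists_mem m
    have hz' : z = fun k => (m k : ZMod q) := funext fun k => (hm k).symm
    refine ⟨projQ L q ⟨x, hx⟩, (hs ⟨x, hx⟩ m hxm).2 (hz' ▸ hz), ?_⟩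
    funext k
    rw [← hm k]
    exact (h.projQ_eq_iff (hn _) hxm).1 (hrep _) k

end IsCoordinates

theorem equivCharQuasi_one (Φ : Set E) (q : ℕ) :
    equivCharQuasi Φ q 1 = charQuasi Φ (coweightLattice Φ) q := by
  rw [equivCharQuasi, charQuasi, Set.sep_eq_self_iff_mem_true.2]
  rintro p ⟨x, hx, -⟩
  exact ⟨x, x, rfl, hx, hx⟩

theorem projQ_mem_complementModQ {Φ : Set E} {L : AddSubgroup E} {q : ℕ}
    (hΦ : ∀ x ∈ L, ∀ β ∈ Φ, ∃ n : ℤ, inner ℝ β x = n) (x : L) :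
    projQ L q x ∈ complementModQ Φ L q ↔
      ∀ β ∈ Φ, ¬∃ n : ℤ, inner ℝ β (x : E) = (q : ℝ) * n := by
  refine ⟨?_, fun h => ⟨x, rfl, h⟩⟩
  rintro ⟨y, hxy, hy⟩ β hβ ⟨n, hn⟩
  obtain ⟨z, hz⟩ := projQ_eq_iff.1 hxy
  obtain ⟨k, hk⟩ := hΦ z z.2 β hβ
  refine hy β hβ ⟨n - k, ?_⟩
  rw [hz, inner_add_right, inner_smul_right, hk] at hn
  push_cast
  linarith

theorem exists_intCast_eq_mul_iff {q : ℕ} {k : ℤ} :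
    (∃ n : ℤ, (k : ℝ) = (q : ℝ) * n) ↔ (k : ZMod q) = 0 := by
  rw [ZMod.intCast_zmod_eq_zero_iff_dvd]
  exact exists_congr fun n => by exact_mod_cast Iff.rfl

theorem not_exists_inner_neg_eq_mul {q : ℕ} {x β : E}
    (h : ¬∃ n : ℤ, inner ℝ β x = (q : ℝ) * n) :
    ¬∃ n : ℤ, inner ℝ (-β) x = (q : ℝ) * n := by
  rintro ⟨n, hn⟩
  refine h ⟨-n, ?_⟩
  rw [inner_neg_left] at hn
  push_cast
  linarith

variable {ι : Type*} {v : ι → E}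

theorem forall_typeCRoots_iff_isRegular {q : ℕ} {x : E} {t : ℤ} {u : ι → ℤ}
    (hx : ∀ i, inner ℝ (v i) x = u i + t / 2) :
    (∀ β ∈ typeCRoots v, ¬∃ n : ℤ, inner ℝ β x = (q : ℝ) * n) ↔
      IsRegular (t : ZMod q) fun i => (u i : ZMod q) := by
  have hsub : ∀ i j, inner ℝ (v i - v j) x = ((u i - u j : ℤ) : ℝ) := fun i j => by
    rw [inner_sub_left, hx, hx]
    push_cast
    ring
  have hadd : ∀ i j, inner ℝ (v i + v j) x = ((u i + u j + t : ℤ) : ℝ) := fun i j => by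
    rw [inner_add_left, hx, hx]
    push_cast
    ring
  rw [forall_typeCRoots (p := fun β => ¬∃ n : ℤ, inner ℝ β x = (q : ℝ) * n)
    fun _ => not_exists_inner_neg_eq_mul]
  simp only [hsub, hadd, exists_intCast_eq_mul_iff]
  simp only [Int.cast_sub, Int.cast_add, sub_eq_zero, IsRegular, Function.Injective]
  exact and_congr_left' (forall₂_congr fun i j => not_imp_not)

theorem forall_typeBCRoots_iff_forall_typeCRoots {q : ℕ} {x : E} :
    (∀ β ∈ typeBCRoots v, ¬∃ n : ℤ, inner ℝ β x = (q : ℝ) * n) ↔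
      ∀ β ∈ typeCRoots v, ¬∃ n : ℤ, inner ℝ β x = (q : ℝ) * n := by
  rw [forall_typeBCRoots (p := fun β => ¬∃ n : ℤ, inner ℝ β x = (q : ℝ) * n)
    fun _ => not_exists_inner_neg_eq_mul, and_iff_left_iff_imp]
  rintro h i ⟨n, hn⟩
  refine h _ (add_mem_typeCRoots i i) ⟨2 * n, ?_⟩
  rw [inner_add_left, hn]
  push_cast
  ring

theorem span_typeCRoots (v : ι → E) :
    Submodule.span ℝ (typeCRoots v) = Submodule.span ℝ (Set.range v) := by
  have hmem : ∀ i, v i ∈ Submodule.span ℝ (Set.range v) := fun i => Submodule.subset_span ⟨i, rfl⟩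
  refine le_antisymm (Submodule.span_le.2 ?_) (Submodule.span_le.2 ?_)
  · exact (forall_typeCRoots (p := (· ∈ Submodule.span ℝ (Set.range v)))
      fun _ => Submodule.neg_mem _).2 ⟨fun i j _ => Submodule.sub_mem _ (hmem i) (hmem j),
        fun i j => Submodule.add_mem _ (hmem i) (hmem j)⟩
  · rintro _ ⟨i, rfl⟩
    have h := Submodule.smul_mem _ (2⁻¹ : ℝ)
      (Submodule.subset_span (add_mem_typeCRoots (v := v) i i))
    rwa [← two_smul ℝ, inv_smul_smul₀ two_ne_zero] at h

theorem span_typeBCRoots (v : ι → E) :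
    Submodule.span ℝ (typeBCRoots v) = Submodule.span ℝ (Set.range v) := by
  refine le_antisymm (Submodule.span_le.2 ?_) (Submodule.span_mono ?_)
  · refine (forall_typeBCRoots (p := (· ∈ Submodule.span ℝ (Set.range v)))
      fun _ => Submodule.neg_mem _).2 ⟨?_, fun i => Submodule.subset_span ⟨i, rfl⟩⟩
    rw [← span_typeCRoots]
    exact Submodule.subset_span
  · rintro _ ⟨i, rfl⟩
    exact mem_typeBCRoots i

theorem mem_coweightLattice_typeCRoots {x : E} {t : ℤ} {u : ι → ℤ}
    (hspan : x ∈ Submodule.span ℝ (Set.range v)) (hx : ∀ i, inner ℝ (v i) x = u i + t / 2) :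
    x ∈ coweightLattice (typeCRoots v) := by
  refine ⟨(span_typeCRoots v).symm ▸ hspan,
    (forall_typeCRoots (p := fun β => ∃ n : ℤ, inner ℝ β x = n) ?_).2
      ⟨fun i j _ => ?_, fun i j => ?_⟩⟩
  · rintro β ⟨n, hn⟩
    exact ⟨-n, by rw [inner_neg_left, hn, Int.cast_neg]⟩
  · refine ⟨u i - u j, ?_⟩
    rw [inner_sub_left, hx, hx]
    push_cast
    ring
  · refine ⟨u i + u j + t, ?_⟩
    rw [inner_add_left, hx, hx]
    push_cast
    ring

end Lattice

section TypeC

variable {E : Type*} [NormedAddCommGroup E] [InnerProductSpace ℝ E]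
  {ι : Type*} [DecidableEq ι] {d : ℝ} {v : ι → E}

/-- The coordinates `2 x r` and `x k - x r` (`k ≠ r`) on the coweight lattice of type `C`. -/
def coordC (v : ι → E) (r k : ι) : E :=
  if k = r then v r + v r else v k - v r

theorem inner_eq_of_inner_coordC {r : ι} {x : E} {n : ι → ℤ}
    (hn : ∀ k, inner ℝ (coordC v r k) x = n k) (k : ι) :
    inner ℝ (v k) x = (Function.update n r 0 k : ℤ) + (n r : ℝ) / 2 := by
  have hr : inner ℝ (v r) x = (n r : ℝ) / 2 := by
    have := hn r
    rw [coordC, if_pos rfl, inner_add_left] at this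
    linarith
  by_cases hk : k = r
  · rw [hk, Function.update_self, hr, Int.cast_zero, zero_add]
  · have := hn k
    rw [coordC, if_neg hk, inner_sub_left, hr] at this
    rw [Function.update_of_ne hk]
    linarith

theorem IsOrthogonalFrame.isCoordinates_coordC [Finite ι] (h : IsOrthogonalFrame d v) (r : ι) :
    IsCoordinates (coweightLattice (typeCRoots v)) (coordC v r) where
  integral x hx k := by
    rw [coordC]
    split_ifs with hk
    · exact hx.2 _ (add_mem_typeCRoots r r)
    · exact hx.2 _ (sub_mem_typeCRoots hk)
  eq_zero x hx h0 := by
    refine eq_zero_of_mem_span_of_inner_eq_zero (span_typeCRoots v ▸ hx.1) fun k => ?_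
    rw [inner_eq_of_inner_coordC (n := 0) (fun k => by simpa using h0 k) k]
    simp
  exists_mem n := by
    have := Fintype.ofFinite ι
    refine ⟨dualVec d v fun k => (Function.update n r 0 k : ℤ) + (n r : ℝ) / 2,
      mem_coweightLattice_typeCRoots (dualVec_mem_span d v _) (h.inner_dualVec _), fun k => ?_⟩
    by_cases hk : k = r
    · rw [hk, coordC, if_pos rfl, inner_add_left, h.inner_dualVec, Function.update_self,
        Int.cast_zero, zero_add, add_halves]
    · rw [coordC, if_neg hk, inner_sub_left, h.inner_dualVec, h.inner_dualVec,
        Function.update_of_ne hk, Function.update_self, Int.cast_zero]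
      ring

theorem projQ_mem_complementModQ_typeCRoots {r : ι} {q : ℕ}
    {x : coweightLattice (typeCRoots v)} {n : ι → ℤ}
    (hn : ∀ k, inner ℝ (coordC v r k) (x : E) = n k) :
    projQ _ q x ∈ complementModQ (typeCRoots v) (coweightLattice (typeCRoots v)) q ↔
      (fun k => (n k : ZMod q)) ∈ regularTuples (ZMod q) r := by
  have hcast : (fun k => ((Function.update n r 0 k : ℤ) : ZMod q)) =
      Function.update (fun k => (n k : ZMod q)) r 0 := by
    funext k
    by_cases hk : k = r
    · rw [hk, Function.update_self, Function.update_self, Int.cast_zero]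
    · rw [Function.update_of_ne hk, Function.update_of_ne hk]
  rw [projQ_mem_complementModQ (fun _ (hx : _ ∈ coweightLattice _) => hx.2),
    forall_typeCRoots_iff_isRegular (inner_eq_of_inner_coordC hn), hcast]
  rfl

theorem IsOrthogonalFrame.charQuasi_typeCRoots [Finite ι] (h : IsOrthogonalFrame d v) (r : ι)
    (q : ℕ) :
    charQuasi (typeCRoots v) (coweightLattice (typeCRoots v)) q =
      (regularTuples (ZMod q) r).ncard :=
  (h.isCoordinates_coordC r).ncard_eq _ _ fun _ _ => projQ_mem_complementModQ_typeCRoots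

end TypeC

section TypeBC

variable {E : Type*} [NormedAddCommGroup E] [InnerProductSpace ℝ E] {ι : Type*} {d : ℝ} {v : ι → E}

theorem mem_coweightLattice_typeBCRoots {x : E} {u : ι → ℤ}
    (hspan : x ∈ Submodule.span ℝ (Set.range v)) (hx : ∀ i, inner ℝ (v i) x = u i) :
    x ∈ coweightLattice (typeBCRoots v) := by
  refine ⟨(span_typeBCRoots v).symm ▸ hspan,
    (forall_typeBCRoots (p := fun β => ∃ n : ℤ, inner ℝ β x = n) ?_).2
      ⟨(mem_coweightLattice_typeCRoots (t := 0) (u := u) hspan fun i => ?_).2,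
        fun i => ⟨u i, hx i⟩⟩⟩
  · rintro β ⟨n, hn⟩
    exact ⟨-n, by rw [inner_neg_left, hn, Int.cast_neg]⟩
  · rw [hx, Int.cast_zero, zero_div, add_zero]

theorem IsOrthogonalFrame.isCoordinates_typeBCRoots [Finite ι] (h : IsOrthogonalFrame d v) :
    IsCoordinates (coweightLattice (typeBCRoots v)) v where
  integral _ hx k := hx.2 _ (mem_typeBCRoots k)
  eq_zero _ hx h0 := eq_zero_of_mem_span_of_inner_eq_zero (span_typeBCRoots v ▸ hx.1) h0
  exists_mem n := by
    have := Fintype.ofFinite ι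
    exact ⟨dualVec d v fun k => n k,
      mem_coweightLattice_typeBCRoots (dualVec_mem_span d v _) (h.inner_dualVec _),
      h.inner_dualVec _⟩

theorem smul_typeBCRoots (c : ℝ) (v : ι → E) :
    c • typeBCRoots v = typeBCRoots fun i => c • v i :=
  image_typeBCRoots (DistribSMul.toAddMonoidHom E c) v

theorem IsOrthogonalFrame.charQuasi_two_smul_typeBCRoots [Finite ι] (h : IsOrthogonalFrame d v)
    (q : ℕ) :
    charQuasi ((2 : ℝ) • typeBCRoots v) (coweightLattice (typeBCRoots v)) q =
      (doubleRegularTuples ι (ZMod q)).ncard := by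
  refine h.isCoordinates_typeBCRoots.ncard_eq _ _ fun x n hn => ?_
  have hint : ∀ x ∈ coweightLattice (typeBCRoots v), ∀ β ∈ (2 : ℝ) • typeBCRoots v,
      ∃ n : ℤ, inner ℝ β x = n := by
    rintro x hx _ ⟨β, hβ, rfl⟩
    obtain ⟨n, hn⟩ := hx.2 β hβ
    exact ⟨2 * n, by simp [inner_smul_left, hn]⟩
  have hdouble : ∀ i, inner ℝ ((2 : ℝ) • v i) (x : E) = (2 * n i : ℤ) + (0 : ℤ) / 2 := fun i => by
    simp [inner_smul_left, hn]
  rw [projQ_mem_complementModQ hint, smul_typeBCRoots, forall_typeBCRoots_iff_forall_typeCRoots,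
    forall_typeCRoots_iff_isRegular hdouble, doubleRegularTuples]
  have hcast : (fun i => ((2 * n i : ℤ) : ZMod q)) = 2 • fun i => (n i : ZMod q) :=
    funext fun i => by simp
  rw [hcast, Int.cast_zero]
  rfl

end TypeBC

section Twist

variable {E : Type*} [NormedAddCommGroup E] [InnerProductSpace ℝ E] {m : ℕ} {d : ℝ}
  {v : Fin (2 * m + 1) → E} {w : E ≃ₗᵢ[ℝ] E}

theorem inner_coordC_map (hw : ∀ k, w (v k) = -v k.rev) (k : Fin (2 * m + 1)) (x : E) :
    inner ℝ (coordC v (midIndex m) k) (w x) = -inner ℝ (coordC v (midIndex m) k.rev) x := by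
  have hcoord : w (coordC v (midIndex m) k.rev) = -coordC v (midIndex m) k := by
    by_cases hk : k = midIndex m
    · rw [hk, rev_midIndex, coordC, if_pos rfl, map_add, hw, rev_midIndex, neg_add]
    · have hk' : k.rev ≠ midIndex m := fun h => hk (by rw [← Fin.rev_rev k, h, rev_midIndex])
      rw [coordC, coordC, if_neg hk', if_neg hk, map_sub, hw, hw, Fin.rev_rev, rev_midIndex]
      abel
  rw [← neg_neg (coordC v (midIndex m) k), ← hcoord, inner_neg_left, w.inner_map_map]

theorem IsOrthogonalFrame.exists_projQ_eq_map_iff (h : IsOrthogonalFrame d v)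
    (hspan : Submodule.span ℝ (Set.range v) = ⊤) (hw : ∀ k, w (v k) = -v k.rev) {q : ℕ}
    {x : coweightLattice (typeCRoots v)} {n : Fin (2 * m + 1) → ℤ}
    (hn : ∀ k, inner ℝ (coordC v (midIndex m) k) (x : E) = n k) :
    (∃ x' y : coweightLattice (typeCRoots v), (y : E) = w x' ∧ projQ _ q x' = projQ _ q x ∧
      projQ _ q y = projQ _ q x) ↔ ∀ k, (n k : ZMod q) + n k.rev = 0 := by
  have hcoord := h.isCoordinates_coordC (midIndex m)
  constructor
  · rintro ⟨x', y, hy, hx', hyx⟩ k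
    choose n' hn' using hcoord.integral x' x'.2
    have hny : ∀ k, inner ℝ (coordC v (midIndex m) k) (y : E) = (-n' k.rev : ℤ) := fun k => by
      rw [hy, inner_coordC_map hw, hn', Int.cast_neg]
    rw [← (hcoord.projQ_eq_iff hny hn).1 hyx, ← (hcoord.projQ_eq_iff hn' hn).1 hx']
    simp
  · intro hfix
    obtain ⟨y, hy, hyn⟩ := hcoord.exists_mem fun k => -n k.rev
    have hywx : ∀ k, inner ℝ (v k) (y - w x) = 0 := fun k => by
      have := inner_eq_of_inner_coordC (v := v) (r := midIndex m) (x := y - w x) (n := 0)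
        (fun k => by simp [inner_sub_right, hyn, inner_coordC_map hw, hn]) k
      simpa using this
    refine ⟨x, ⟨y, hy⟩, sub_eq_zero.1 (eq_zero_of_mem_span_of_inner_eq_zero
      (hspan.symm ▸ Submodule.mem_top) hywx), rfl, (hcoord.projQ_eq_iff hyn hn).2 fun k => ?_⟩
    rw [Int.cast_neg, neg_eq_iff_add_eq_zero, add_comm]
    exact hfix k

theorem IsOrthogonalFrame.equivCharQuasi_typeCRoots (h : IsOrthogonalFrame d v)
    (hspan : Submodule.span ℝ (Set.range v) = ⊤) (hw : ∀ k, w (v k) = -v k.rev) (q : ℕ) :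
    equivCharQuasi (typeCRoots v) q w = (fixedTuples m (ZMod q)).ncard :=
  (h.isCoordinates_coordC (midIndex m)).ncard_eq _ _ fun _ _ hn =>
    and_congr (projQ_mem_complementModQ_typeCRoots hn) (h.exists_projQ_eq_map_iff hspan hw hn)

end Twist

section Folding

variable {E : Type*} [NormedAddCommGroup E] [InnerProductSpace ℝ E]

theorem average_add (w : E ≃ₗᵢ[ℝ] E) (x y : E) :
    average w (x + y) = average w x + average w y := by
  simp only [average, map_add, Finset.sum_add_distrib, smul_add]

theorem average_of_orderOf_eq_two {w : E ≃ₗᵢ[ℝ] E} (hw : orderOf w = 2) (x : E) :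
    average w x = (2⁻¹ : ℝ) • (x + w x) := by
  have hsq : w ^ 2 = 1 := hw ▸ pow_orderOf_eq_one w
  rw [average, hw, Nat.cast_ofNat, show Finset.Icc 1 2 = {1, 2} from rfl,
    Finset.sum_pair (OfNat.one_ne_ofNat 2), pow_one, hsq, LinearIsometryEquiv.coe_one, id, add_comm]

theorem folding_typeCRoots {ι : Type*} (w : E ≃ₗᵢ[ℝ] E) (v : ι → E) :
    folding (typeCRoots v) w = typeCRoots (fun k => average w (v k)) \ {0} := by
  have himage : average w '' typeCRoots v = typeCRoots fun k => average w (v k) :=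
    image_typeCRoots (AddMonoidHom.mk' (average w) (average_add w)) v
  rw [← himage]
  exact Set.ext fun y => and_comm

theorem IsOrthogonalFrame.isRegular_zero {ι : Type*} {d : ℝ} {v : ι → E}
    (h : IsOrthogonalFrame d v) : IsRegular (0 : E) v := by
  refine ⟨fun i j hij => ?_, fun i j hij => ?_⟩
  · by_contra hne
    exact h.pos.ne (by rw [← h.inner_ne i j hne, ← hij, h.inner_self])
  · have hinner : d + inner ℝ (v i) (v j) = 0 := by
      rw [← h.inner_self i, ← inner_add_right, ← add_zero (v i + v j), hij, inner_zero_right]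
    by_cases hne : i = j
    · rw [hne, h.inner_self] at hinner
      linarith [h.pos]
    · rw [h.inner_ne i j hne] at hinner
      linarith [h.pos]

variable {m : ℕ} {d : ℝ} {v : Fin (2 * m + 1) → E} {w : E ≃ₗᵢ[ℝ] E}

/-- The averages of the first `m` vectors of `v` under `v k ↦ -v k.rev`; they span the fixed space
of this map. -/
noncomputable def foldedFrame (v : Fin (2 * m + 1) → E) (i : Fin m) : E :=
  (2⁻¹ : ℝ) • (v (lowIndex i) - v (lowIndex i).rev)

theorem rev_lowIndex_ne_lowIndex (i j : Fin m) : (lowIndex i).rev ≠ lowIndex j := fun h => by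
  have := Fin.ext_iff.1 h
  simp only [lowIndex, Fin.val_rev] at this
  omega

theorem IsOrthogonalFrame.foldedFrame (h : IsOrthogonalFrame d v) :
    IsOrthogonalFrame (d / 2) (foldedFrame v) := by
  have hinner : ∀ i j, inner ℝ (RootChar.foldedFrame v i) (RootChar.foldedFrame v j) =
      4⁻¹ * (inner ℝ (v (lowIndex i)) (v (lowIndex j)) +
        inner ℝ (v (lowIndex i).rev) (v (lowIndex j).rev)) := fun i j => by
    simp only [RootChar.foldedFrame, inner_smul_left, inner_smul_right, inner_sub_left,
      inner_sub_right, h.inner_ne _ _ (rev_lowIndex_ne_lowIndex i j),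
      h.inner_ne _ _ (rev_lowIndex_ne_lowIndex j i).symm, conj_trivial]
    ring
  refine ⟨half_pos h.pos, fun i => ?_, fun i j hij => ?_⟩
  · rw [hinner, h.inner_self, h.inner_self]
    ring
  · have hlow : lowIndex i ≠ lowIndex j := fun hlow => hij (Fin.ext (Fin.mk.inj hlow))
    rw [hinner, h.inner_ne _ _ hlow, h.inner_ne _ _ (Fin.rev_injective.ne hlow), add_zero, mul_zero]

theorem IsOrthogonalFrame.orderOf_eq_two (h : IsOrthogonalFrame d v)
    (hspan : Submodule.span ℝ (Set.range v) = ⊤) (hw : ∀ k, w (v k) = -v k.rev) :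
    orderOf w = 2 := by
  refine orderOf_eq_prime (linearIsometryEquiv_ext_of_span_eq_top hspan fun k => ?_) fun h1 => ?_
  · rw [pow_two, LinearIsometryEquiv.coe_mul, Function.comp_apply, hw, map_neg, hw, Fin.rev_rev,
      neg_neg, LinearIsometryEquiv.coe_one, id]
  · have hmid := hw (midIndex m)
    rw [h1, LinearIsometryEquiv.coe_one, id, rev_midIndex, eq_neg_iff_add_eq_zero] at hmid
    exact h.isRegular_zero.2 _ _ (by rw [add_zero, hmid])

theorem average_eq_oddExtension (hw2 : orderOf w = 2) (hw : ∀ k, w (v k) = -v k.rev) :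
    (fun k => average w (v k)) = oddExtension (foldedFrame v) := by
  have haverage : ∀ k, average w (v k) = (2⁻¹ : ℝ) • (v k - v k.rev) := fun k => by
    rw [average_of_orderOf_eq_two hw2, hw, sub_eq_add_neg]
  simp only [haverage]
  refine eq_oddExtension (by rw [rev_midIndex, sub_self, smul_zero]) fun i => ?_
  rw [Fin.rev_rev, ← smul_neg, neg_sub]

theorem IsOrthogonalFrame.folding_typeCRoots (h : IsOrthogonalFrame d v)
    (hspan : Submodule.span ℝ (Set.range v) = ⊤) (hw : ∀ k, w (v k) = -v k.rev) :
    folding (typeCRoots v) w = typeBCRoots (RootChar.foldedFrame v) := by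
  rw [RootChar.folding_typeCRoots, average_eq_oddExtension (h.orderOf_eq_two hspan hw) hw]
  exact typeCRoots_oddExtension_diff_zero h.foldedFrame.isRegular_zero

end Folding

section TypeCOmega

variable {E : Type*} [NormedAddCommGroup E] [InnerProductSpace ℝ E] {Φ : Set E}

theorem IsTypeC.equivCharQuasi_one {n : ℕ} {α : Fin (n + 1) → E} (hΦ : IsTypeC (n + 1) Φ α)
    (q : ℕ) : equivCharQuasi Φ q 1 = (regularTuples (ZMod q) (Fin.last n)).ncard := by
  obtain ⟨d, v, hv, -, rfl, -⟩ := hΦ.exists_isOrthogonalFrame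
  rw [RootChar.equivCharQuasi_one, hv.charQuasi_typeCRoots (Fin.last n)]

theorem IsTypeC.equivCharQuasi_one_of_odd {n : ℕ} {α : Fin (n + 1) → E}
    (hΦ : IsTypeC (n + 1) Φ α) {q : ℕ} [NeZero q] (hq : Odd q) :
    (equivCharQuasi Φ q 1 : ℤ) = ∏ i ∈ Finset.Icc 1 (n + 1), ((q : ℤ) - (2 * (i : ℤ) - 1)) := by
  rw [hΦ.equivCharQuasi_one, ncard_regularTuples_zmod_of_odd _ hq, Fintype.card_fin]

theorem IsTypeC.equivCharQuasi_one_of_even {n : ℕ} {α : Fin (n + 1) → E}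
    (hΦ : IsTypeC (n + 1) Φ α) {q : ℕ} [NeZero q] (hq : Even q) :
    (equivCharQuasi Φ q 1 : ℤ) =
      (∏ i ∈ Finset.Icc 1 n, ((q : ℤ) - 2 * (i : ℤ))) * ((q : ℤ) - (n + 1 : ℕ)) := by
  rw [hΦ.equivCharQuasi_one, ncard_regularTuples_zmod_of_even _ hq, Fintype.card_fin,
    Nat.add_sub_cancel]

variable {m : ℕ} {α : Fin (2 * m + 1) → E}

theorem IsTypeC.exists_isOrthogonalFrame_omega_apply (hΦ : IsTypeC (2 * m + 1) Φ α) :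
    ∃ (d : ℝ) (v : Fin (2 * m + 1) → E), IsOrthogonalFrame d v ∧
      Submodule.span ℝ (Set.range v) = ⊤ ∧ Φ = typeCRoots v ∧
      ∀ k, omega α (Fin.last (2 * m)) (v k) = -v k.rev := by
  obtain ⟨d, v, hv, hspan, rfl, rfl⟩ := hΦ.exists_isOrthogonalFrame
  exact ⟨d, v, hv, hspan, rfl, hv.omega_apply hspan⟩

theorem IsTypeC.equivCharQuasi_omega (hΦ : IsTypeC (2 * m + 1) Φ α) (q : ℕ) :
    equivCharQuasi Φ q (omega α (Fin.last (2 * m))) = (fixedTuples m (ZMod q)).ncard := by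
  obtain ⟨d, v, hv, hspan, rfl, hw⟩ := hΦ.exists_isOrthogonalFrame_omega_apply
  exact hv.equivCharQuasi_typeCRoots hspan hw q

theorem IsTypeC.exists_folding_omega_eq_typeBCRoots (hΦ : IsTypeC (2 * m + 1) Φ α) :
    ∃ (d : ℝ) (h : Fin m → E), IsOrthogonalFrame d h ∧
      folding Φ (omega α (Fin.last (2 * m))) = typeBCRoots h := by
  obtain ⟨d, v, hv, hspan, rfl, hw⟩ := hΦ.exists_isOrthogonalFrame_omega_apply
  exact ⟨d / 2, foldedFrame v, hv.foldedFrame, hv.folding_typeCRoots hspan hw⟩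

theorem IsTypeC.equivCharQuasi_omega_of_gcd_eq_one (hΦ : IsTypeC (2 * m + 1) Φ α) {q : ℕ}
    (hq : Nat.gcd 4 q = 1) : equivCharQuasi Φ q (omega α (Fin.last (2 * m))) = 0 := by
  have hodd : Odd q := Nat.coprime_two_left.1 (Nat.Coprime.coprime_dvd_left ⟨2, rfl⟩ hq)
  rw [hΦ.equivCharQuasi_omega, ncard_fixedTuples_zmod_of_odd hodd]

theorem IsTypeC.equivCharQuasi_omega_of_even (hΦ : IsTypeC (2 * m + 1) Φ α) {q : ℕ} [NeZero q]
    (hq : Even q) : (equivCharQuasi Φ q (omega α (Fin.last (2 * m))) : ℤ) =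
      ∏ i ∈ Finset.range m, ((q : ℤ) - Nat.gcd 4 q - 4 * i) := by
  rw [hΦ.equivCharQuasi_omega, ncard_fixedTuples_zmod_of_even hq, ncard_doubleRegularTuples_zmod hq,
    Fintype.card_fin]

theorem IsTypeC.equivCharQuasi_omega_of_gcd_eq_two (hΦ : IsTypeC (2 * m + 1) Φ α) {q : ℕ}
    [NeZero q] (hq : Nat.gcd 4 q = 2) :
    (equivCharQuasi Φ q (omega α (Fin.last (2 * m))) : ℤ) =
      ∏ i ∈ Finset.Icc 1 m, ((q : ℤ) - 2 * (2 * (i : ℤ) - 1)) := by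
  have heven : Even q := even_iff_two_dvd.2 (hq ▸ Nat.gcd_dvd_right 4 q)
  rw [hΦ.equivCharQuasi_omega_of_even heven, hq, prod_Icc_one_eq_prod_range]
  refine Finset.prod_congr rfl fun i _ => ?_
  push_cast
  ring

theorem IsTypeC.equivCharQuasi_omega_of_gcd_eq_four (hΦ : IsTypeC (2 * m + 1) Φ α) {q : ℕ}
    [NeZero q] (hq : Nat.gcd 4 q = 4) :
    (equivCharQuasi Φ q (omega α (Fin.last (2 * m))) : ℤ) =
      ∏ i ∈ Finset.Icc 1 m, ((q : ℤ) - 4 * (i : ℤ)) := by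
  have heven : Even q := even_iff_two_dvd.2
    ((Nat.dvd_mul_right 2 2).trans (Nat.gcd_eq_left_iff_dvd.1 hq))
  rw [hΦ.equivCharQuasi_omega_of_even heven, hq, prod_Icc_one_eq_prod_range]
  refine Finset.prod_congr rfl fun i _ => ?_
  push_cast
  ring

theorem IsTypeC.equivCharQuasi_omega_eq_charQuasi_folding (hΦ : IsTypeC (2 * m + 1) Φ α) {q : ℕ}
    [NeZero q] (hq : Even q) : equivCharQuasi Φ q (omega α (Fin.last (2 * m))) =
      charQuasi ((2 : ℝ) • folding Φ (omega α (Fin.last (2 * m))))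
        (coweightLattice (folding Φ (omega α (Fin.last (2 * m))))) q := by
  obtain ⟨d, h, hh, hfold⟩ := hΦ.exists_folding_omega_eq_typeBCRoots
  rw [hfold, hΦ.equivCharQuasi_omega, ncard_fixedTuples_zmod_of_even hq,
    hh.charQuasi_two_smul_typeBCRoots]

theorem IsTypeC.isTypeBC_folding_omega (hΦ : IsTypeC (2 * m + 1) Φ α) :
    IsTypeBC m (folding Φ (omega α (Fin.last (2 * m)))) := by
  obtain ⟨d, h, hh, hfold⟩ := hΦ.exists_folding_omega_eq_typeBCRoots
  exact hfold ▸ hh.isTypeBC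

end TypeCOmega

end RootChar

theorem mainTheorem7_general {E : Type*} [NormedAddCommGroup E] [InnerProductSpace ℝ E]
    (l : ℕ) (Φ : Set E) (α : Fin l → E) (hΦ : IsTypeC l Φ α)
    (j : Fin l) (hj : (j : ℕ) + 1 = l) :
    (∀ q : ℕ, 0 < q →
      equivCharQuasi Φ q 1 = charQuasi Φ (coweightLattice Φ) q ∧
      (Odd q → (equivCharQuasi Φ q 1 : ℤ) =
        ∏ i ∈ Finset.Icc 1 l, ((q : ℤ) - (2 * (i : ℤ) - 1))) ∧
      (Even q → (equivCharQuasi Φ q 1 : ℤ) =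
        (∏ i ∈ Finset.Icc 1 (l - 1), ((q : ℤ) - 2 * (i : ℤ))) * ((q : ℤ) - (l : ℤ)))) ∧
    (Odd l →
      (∀ q : ℕ, 0 < q →
        (Nat.gcd 4 q = 1 → equivCharQuasi Φ q (omega α j) = 0) ∧
        (Nat.gcd 4 q = 2 → (equivCharQuasi Φ q (omega α j) : ℤ) =
          ∏ i ∈ Finset.Icc 1 ((l - 1) / 2), ((q : ℤ) - 2 * (2 * (i : ℤ) - 1))) ∧
        (Nat.gcd 4 q = 4 → (equivCharQuasi Φ q (omega α j) : ℤ) =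
          ∏ i ∈ Finset.Icc 1 ((l - 1) / 2), ((q : ℤ) - 4 * (i : ℤ)))) ∧
      (IsTypeBC ((l - 1) / 2) (folding Φ (omega α j)) ∧
        ∀ q : ℕ, 0 < q → Even q →
          equivCharQuasi Φ q (omega α j) =
            charQuasi ((2 : ℝ) • folding Φ (omega α j))
              (coweightLattice (folding Φ (omega α j))) q)) := by
  obtain ⟨n, rfl⟩ : ∃ n, l = n + 1 := ⟨j, hj.symm⟩
  obtain rfl : j = Fin.last n := Fin.ext (Nat.succ.inj hj)
  refine ⟨fun q hq => ?_, fun ⟨m, hm⟩ => ?_⟩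
  · have : NeZero q := ⟨hq.ne'⟩
    exact ⟨equivCharQuasi_one Φ q, hΦ.equivCharQuasi_one_of_odd, hΦ.equivCharQuasi_one_of_even⟩
  · obtain rfl : n = 2 * m := Nat.succ.inj hm
    rw [show (2 * m + 1 - 1) / 2 = m by omega]
    refine ⟨fun q hq => ?_, hΦ.isTypeBC_folding_omega, fun q hq => ?_⟩
    · have : NeZero q := ⟨hq.ne'⟩
      exact ⟨hΦ.equivCharQuasi_omega_of_gcd_eq_one, hΦ.equivCharQuasi_omega_of_gcd_eq_two,
        hΦ.equivCharQuasi_omega_of_gcd_eq_four⟩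
    · have : NeZero q := ⟨hq.ne'⟩
      exact hΦ.equivCharQuasi_omega_eq_charQuasi_folding

theorem mainTheorem7 {E : Type*} [NormedAddCommGroup E] [InnerProductSpace ℝ E]
    (l : ℕ) (hl : Odd l) (Φ : Set E) (α : Fin l → E) (hΦ : IsTypeC l Φ α)
    (j : Fin l) (hj : (j : ℕ) + 1 = l) :
    -- the value at the identity
    (∀ q : ℕ, 0 < q →
      equivCharQuasi Φ q 1 = charQuasi Φ (coweightLattice Φ) q ∧
      (Odd q → (equivCharQuasi Φ q 1 : ℤ) =
        ∏ i ∈ Finset.Icc 1 l, ((q : ℤ) - (2 * (i : ℤ) - 1))) ∧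
      (Even q → (equivCharQuasi Φ q 1 : ℤ) =
        (∏ i ∈ Finset.Icc 1 (l - 1), ((q : ℤ) - 2 * (i : ℤ))) * ((q : ℤ) - (l : ℤ)))) ∧
    -- the value at `ω_ℓ`
    (∀ q : ℕ, 0 < q →
      (Nat.gcd 4 q = 1 → equivCharQuasi Φ q (omega α j) = 0) ∧
      (Nat.gcd 4 q = 2 → (equivCharQuasi Φ q (omega α j) : ℤ) =
        ∏ i ∈ Finset.Icc 1 ((l - 1) / 2), ((q : ℤ) - 2 * (2 * (i : ℤ) - 1))) ∧
      (Nat.gcd 4 q = 4 → (equivCharQuasi Φ q (omega α j) : ℤ) =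
        ∏ i ∈ Finset.Icc 1 ((l - 1) / 2), ((q : ℤ) - 4 * (i : ℤ)))) ∧
    -- the folding by `ω_ℓ` is of type `BC`, and its dilation by `2` gives the value at `ω_ℓ`
    (IsTypeBC ((l - 1) / 2) (folding Φ (omega α j)) ∧
      ∀ q : ℕ, 0 < q → Even q →
        equivCharQuasi Φ q (omega α j) =
          charQuasi ((2 : ℝ) • folding Φ (omega α j))
            (coweightLattice (folding Φ (omega α j))) q) :=
  let ⟨hone, homega⟩ := mainTheorem7_general l Φ α hΦ j hj
  ⟨hone, homega hl⟩
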